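/- Let $A\in\mathbb{C}^{n\times n}$ have all its eigenvalues in the open unit disc, let $B\in\mathbb{C}^{n\times m}$ have full column rank, let $(A,B)$ be reachable, and put $G(z)=(zI-A)^{-1}B$. On the unit circle $\mathbb{T}$, let $G^*$ be the conjugate transpose of $G$, and let $\int$ denote integration with respect to the normalized Lebesgue measure $d\vartheta/2\pi$. Let $\Psi$ be a bounded coercive $\mathbb{C}^{m\times m}$-valued spectral density on $\mathbb{T}$, that is, a measurable Hermitian-valued function with $cI\le\Psi\le CI$ almost everywhere for some constants $0<c\le C$. Let $\operatorname{Range}\Gamma$ be the set of all matrices $\Gamma(\Phi)=\int G\Phi G^*$, where $\Phi$ runs over the continuous functions from $\mathbb{T}$ to the Hermitian $m\times m$ matrices, and let $$P_\Gamma=\{\Sigma\in\operatorname{Range}\Gamma : \Sigma>0\},\qquad \mathcal{L}^H_\Gamma=\{\Lambda\in\operatorname{Range}\Gamma : I+G^*\Lambda G>0 \text{ on all of } \mathbb{T}\}.$$ For every $\Sigma\in P_\Gamma$ the functional $$J(\Lambda;\Sigma)=\operatorname{tr}\int (I+G^*\Lambda G)^{-1}\Psi+\operatorname{tr}(\Lambda\Sigma)$$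 has exactly one minimum point $\Lambda^H_{\mathrm{opt}}(\Sigma)$ in $\mathcal{L}^H_\Gamma$, and the function $$\Phi^H_{\mathrm{opt}}(\Sigma)=(I+G^*\Lambda G)^{-1}\,\Psi\,(I+G^*\Lambda G)^{-1},\qquad \Lambda=\Lambda^H_{\mathrm{opt}}(\Sigma),$$ belongs to $L_\infty^{m\times m}(\mathbb{T})$. The map $\Sigma\mapsto\Phi^H_{\mathrm{opt}}(\Sigma)$ is continuous from $P_\Gamma$ to $L_\infty^{m\times m}(\mathbb{T})$. -/

import Mathlib

open MeasureTheory Matrix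
open scoped ENNReal ComplexOrder Matrix.Norms.L2Operator

noncomputable section

namespace HellingerSpectrum

/-- The angle `ϑ`, in `ℝ / 2πℤ`, of the point `e^{iϑ}` of the unit circle. -/
abbrev CircleAngle : Type := AddCircle (2 * Real.pi)

/-- The normalized Lebesgue measure `dϑ / 2π`. -/
abbrev circleMeasure : Measure CircleAngle :=
  haveI : Fact (0 < 2 * Real.pi) := ⟨Real.two_pi_pos⟩
  AddCircle.haarAddCircle

/-- All eigenvalues of `A` lie in the open unit disc. -/
def IsStable {n : ℕ} (A : Matrix (Fin n) (Fin n) ℂ) : Prop :=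
  ∀ μ ∈ spectrum ℂ A, ‖μ‖ < 1

/-- The columns of `B, A B, …, A ^ (n - 1) B` span `ℂⁿ`. -/
def IsReachable {n m : ℕ} (A : Matrix (Fin n) (Fin n) ℂ) (B : Matrix (Fin n) (Fin m) ℂ) : Prop :=
  (⨆ k : Fin n, LinearMap.range (A ^ (k : ℕ) * B).mulVecLin) = ⊤

/-- The transfer function `G(z) = (z I - A)⁻¹ B` at `z = e^{iϑ}`. -/
def transfer {n m : ℕ} (A : Matrix (Fin n) (Fin n) ℂ) (B : Matrix (Fin n) (Fin m) ℂ)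
    (θ : CircleAngle) : Matrix (Fin n) (Fin m) ℂ :=
  ((AddCircle.toCircle θ : ℂ) • (1 : Matrix (Fin n) (Fin n) ℂ) - A)⁻¹ * B

/-- Bounded, coercive spectral densities: `c I ≤ Ψ ≤ C I` almost everywhere on the circle, for
some constants `c > 0` and `C`. -/
structure IsSpectralDensity {m : ℕ} (Ψ : CircleAngle → Matrix (Fin m) (Fin m) ℂ) : Prop where
  aestronglyMeasurable : AEStronglyMeasurable Ψ circleMeasure
  coercive : ∃ c : ℝ, 0 < c ∧
    ∀ᵐ θ ∂circleMeasure, (Ψ θ - c • (1 : Matrix (Fin m) (Fin m) ℂ)).PosSemidef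
  bounded : ∃ C : ℝ,
    ∀ᵐ θ ∂circleMeasure, (C • (1 : Matrix (Fin m) (Fin m) ℂ) - Ψ θ).PosSemidef

/-- `Γ(Φ) = ∫ G Φ G*`. -/
def gammaOp {n m : ℕ} (A : Matrix (Fin n) (Fin n) ℂ) (B : Matrix (Fin n) (Fin m) ℂ)
    (Φ : CircleAngle → Matrix (Fin m) (Fin m) ℂ) : Matrix (Fin n) (Fin n) ℂ :=
  ∫ θ, transfer A B θ * Φ θ * (transfer A B θ)ᴴ ∂circleMeasure

/-- The range of `Γ` on the continuous Hermitian-valued functions on the circle. -/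
def rangeGamma {n m : ℕ} (A : Matrix (Fin n) (Fin n) ℂ) (B : Matrix (Fin n) (Fin m) ℂ) :
    Set (Matrix (Fin n) (Fin n) ℂ) :=
  {S | ∃ Φ : CircleAngle → Matrix (Fin m) (Fin m) ℂ,
    Continuous Φ ∧ (∀ θ, (Φ θ).IsHermitian) ∧ gammaOp A B Φ = S}

/-- `P_Γ`, the positive definite elements of the range of `Γ`. -/
def PGamma {n m : ℕ} (A : Matrix (Fin n) (Fin n) ℂ) (B : Matrix (Fin n) (Fin m) ℂ) :
    Set (Matrix (Fin n) (Fin n) ℂ) :=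
  {S | S ∈ rangeGamma A B ∧ S.PosDef}

/-- `Q_Λ = I + G* Λ G` on the circle. -/
def Q {n m : ℕ} (A : Matrix (Fin n) (Fin n) ℂ) (B : Matrix (Fin n) (Fin m) ℂ)
    (Λ : Matrix (Fin n) (Fin n) ℂ) (θ : CircleAngle) : Matrix (Fin m) (Fin m) ℂ :=
  1 + (transfer A B θ)ᴴ * Λ * transfer A B θ

/-- `𝓛_Γ^H`: the Hermitian matrices `Λ` in the range of `Γ` with `I + G* Λ G > 0` on the whole
circle. -/
def LGamma {n m : ℕ} (A : Matrix (Fin n) (Fin n) ℂ) (B : Matrix (Fin n) (Fin m) ℂ) :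
    Set (Matrix (Fin n) (Fin n) ℂ) :=
  {Λ | Λ.IsHermitian ∧ (∀ θ, (Q A B Λ θ).PosDef) ∧ Λ ∈ rangeGamma A B}

/-- The dual functional `J(Λ; S) = tr ∫ (I + G* Λ G)⁻¹ Ψ + tr (Λ S)`, a real number for
`Λ ∈ 𝓛_Γ^H` and Hermitian `S`. -/
def dualFunctional {n m : ℕ} (A : Matrix (Fin n) (Fin n) ℂ) (B : Matrix (Fin n) (Fin m) ℂ)
    (Ψ : CircleAngle → Matrix (Fin m) (Fin m) ℂ) (S Λ : Matrix (Fin n) (Fin n) ℂ) : ℝ :=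
  (trace (∫ θ, (Q A B Λ θ)⁻¹ * Ψ θ ∂circleMeasure) + trace (Λ * S)).re

/-- `Λ` is a minimum point of `J(·; S)` over `𝓛_Γ^H`. -/
def IsDualMinimizer {n m : ℕ} (A : Matrix (Fin n) (Fin n) ℂ) (B : Matrix (Fin n) (Fin m) ℂ)
    (Ψ : CircleAngle → Matrix (Fin m) (Fin m) ℂ) (S Λ : Matrix (Fin n) (Fin n) ℂ) : Prop :=
  Λ ∈ LGamma A B ∧ IsMinOn (dualFunctional A B Ψ S) (LGamma A B) Λ

/-- `Λ_opt(S) = arg min J(·; S)` over `𝓛_Γ^H`. -/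
def optMultiplier {n m : ℕ} (A : Matrix (Fin n) (Fin n) ℂ) (B : Matrix (Fin n) (Fin m) ℂ)
    (Ψ : CircleAngle → Matrix (Fin m) (Fin m) ℂ) (S : Matrix (Fin n) (Fin n) ℂ) :
    Matrix (Fin n) (Fin n) ℂ :=
  Classical.epsilon (IsDualMinimizer A B Ψ S)

/-- `Φ_opt(S) = (I + G* Λ G)⁻¹ Ψ (I + G* Λ G)⁻¹` with `Λ = Λ_opt(S)`. -/
def optSpectrum {n m : ℕ} (A : Matrix (Fin n) (Fin n) ℂ) (B : Matrix (Fin n) (Fin m) ℂ)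
    (Ψ : CircleAngle → Matrix (Fin m) (Fin m) ℂ) (S : Matrix (Fin n) (Fin n) ℂ) (θ : CircleAngle) :
    Matrix (Fin m) (Fin m) ℂ :=
  (Q A B (optMultiplier A B Ψ S) θ)⁻¹ * Ψ θ * (Q A B (optMultiplier A B Ψ S) θ)⁻¹

end HellingerSpectrum

end

/-! Write Q = I + G*ΛG. The dual functional is continuous and convex on the convex set `LGamma`; the
work lies in confining its sublevel sets to a compact subset of that set, and in a quantitative form
of strict convexity.

Two bounds give compactness. First, every Σ in `PGamma` is Γ(Φ) with Φ continuous and positive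
definite on the whole circle (`exists_posDef_preimage`). The Stein equation satisfied by Σ yields an
explicit such Φ. Since Λ ↦ G*ΛG is adjoint to Γ, tr(ΛΣ) = ∫ tr(QΦ) - ∫ tr Φ. This is bounded below,
and an upper bound on it controls ∫ tr Q, hence Λ (`exists_bounds_rtr_mul`). Second, coercivity of Ψ
turns a bound on J into one on ∫ tr Q⁻¹. As Q is Lipschitz in the angle with a constant depending
only on a bound for Λ, a near-singularity of Q would make this integral logarithmically large, so Q
≥ εI uniformly (`exists_lower_bound_Q`). A minimum over the resulting compact set is a global one
(`exists_isDualMinimizer`).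

Convexity rests on one identity, `inv_sub_eq`: for positive definite P, P⁻¹ exceeds 2X - XPX by (P⁻¹
- X)P(P⁻¹ - X). Taking X to be Q⁻¹ at a convex combination gives convexity of J with a quadratic
remainder (`exists_dualFunctional_convex`). Two minimum points therefore have the same Q, and Λ ↦
G*ΛG is injective on the range of Γ (`compression_injOn`).

For continuity, J depends on Σ only through a linear term. By uniqueness J(·;Σ) has a positive gap
on a small sphere about its minimum point, and convexity keeps the minimum point for a nearby Σ
inside that sphere (`continuous_optMultiplier`). Inversion is continuous in the Banach algebra of
continuous matrix functions, and X ↦ XΨX is continuous from there into L_∞. -/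

noncomputable section

namespace HellingerSpectrum

/-! ### Trace and norm inequalities for positive matrices. -/

section MatrixTrace

variable {k : ℕ}

/-- The real part of the trace, as a continuous real-linear functional. -/
def rtr (k : ℕ) : Matrix (Fin k) (Fin k) ℂ →L[ℝ] ℝ :=
  LinearMap.toContinuousLinearMap
    (Complex.reLm ∘ₗ (Matrix.traceLinearMap (Fin k) ℝ ℂ))

lemma rtr_apply (X : Matrix (Fin k) (Fin k) ℂ) : rtr k X = (trace X).re := rfl

lemma rtr_mul_comm {l : ℕ} (X : Matrix (Fin k) (Fin l) ℂ) (Y : Matrix (Fin l) (Fin k) ℂ) :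
    rtr k (X * Y) = rtr l (Y * X) := by
  rw [rtr_apply, rtr_apply, trace_mul_comm]

lemma rtr_nonneg {X : Matrix (Fin k) (Fin k) ℂ} (hX : X.PosSemidef) : 0 ≤ rtr k X :=
  (Complex.le_def.1 hX.trace_nonneg).1

lemma exists_eq_conjTranspose_mul_self {X : Matrix (Fin k) (Fin k) ℂ} (hX : X.PosSemidef) :
    ∃ C : Matrix (Fin k) (Fin k) ℂ, X = Cᴴ * C := by
  open scoped MatrixOrder in
  obtain ⟨C, hC⟩ := CStarAlgebra.nonneg_iff_eq_star_mul_self.1 (Matrix.nonneg_iff_posSemidef.2 hX)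
  exact ⟨C, hC⟩

/-- With X = C*C, cyclicity turns the trace into that of the positive semidefinite matrix CYC*. -/
lemma rtr_mul_nonneg {X Y : Matrix (Fin k) (Fin k) ℂ} (hX : X.PosSemidef) (hY : Y.PosSemidef) :
    0 ≤ rtr k (X * Y) := by
  obtain ⟨C, rfl⟩ := exists_eq_conjTranspose_mul_self hX
  rw [Matrix.mul_assoc, rtr_mul_comm]
  exact rtr_nonneg (hY.mul_mul_conjTranspose_same C)

lemma posSemidef_norm_smul_one_sub {X : Matrix (Fin k) (Fin k) ℂ} (hX : X.IsHermitian) :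
    (‖X‖ • (1 : Matrix (Fin k) (Fin k) ℂ) - X).PosSemidef := by
  open scoped MatrixOrder in
  have h := IsSelfAdjoint.le_algebraMap_norm_self (a := X) hX
  rw [Algebra.algebraMap_eq_smul_one] at h
  exact Matrix.le_iff.1 h

lemma rtr_vecMulVec (X : Matrix (Fin k) (Fin k) ℂ) (v : Fin k → ℂ) :
    rtr k (X * vecMulVec v (star v)) = (star v ⬝ᵥ X *ᵥ v).re := by
  rw [rtr_apply, mul_vecMulVec, trace_vecMulVec, dotProduct_comm]

/-- The operator norm is unitarily invariant, so it is the largest eigenvalue, while the trace is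
the sum of all of them, each nonnegative. -/
lemma norm_le_rtr {X : Matrix (Fin k) (Fin k) ℂ} (hX : X.PosSemidef) : ‖X‖ ≤ rtr k X := by
  have h0 : 0 ≤ rtr k X := rtr_nonneg hX
  have key : ‖X‖ = ‖(diagonal (fun i => (hX.1.eigenvalues i : ℂ)) : Matrix (Fin k) (Fin k) ℂ)‖ := by
    conv_lhs => rw [hX.1.spectral_theorem, Unitary.conjStarAlgAut_apply]
    rw [← Unitary.coe_star, CStarRing.norm_mul_coe_unitary, CStarRing.norm_coe_unitary_mul]
    rfl
  have ht : rtr k X = ∑ i, hX.1.eigenvalues i := by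
    rw [rtr_apply, hX.1.trace_eq_sum_eigenvalues]
    simp
  rw [key, l2_opNorm_diagonal]
  refine (pi_norm_le_iff_of_nonneg h0).2 fun i => ?_
  rw [ht, Complex.norm_real, Real.norm_of_nonneg (hX.eigenvalues_nonneg i)]
  exact Finset.single_le_sum (f := hX.1.eigenvalues) (fun j _ => hX.eigenvalues_nonneg j)
    (Finset.mem_univ i)

lemma sq_norm_le_rtr (X : Matrix (Fin k) (Fin k) ℂ) : ‖X‖ * ‖X‖ ≤ rtr k (Xᴴ * X) := by
  rw [← l2_opNorm_conjTranspose_mul_self]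
  exact norm_le_rtr (posSemidef_conjTranspose_mul_self X)

/-- Expresses positivity by real inequalities that are closed and linear in X; this makes the
candidate set for the minimum visibly closed. -/
lemma posSemidef_iff_rtr {X : Matrix (Fin k) (Fin k) ℂ} (hX : X.IsHermitian) :
    X.PosSemidef ↔ ∀ v : Fin k → ℂ, 0 ≤ rtr k (X * vecMulVec v (star v)) := by
  refine ⟨fun h v => rtr_mul_nonneg h (posSemidef_vecMulVec_self_star v), fun h => ?_⟩
  refine PosSemidef.of_dotProduct_mulVec_nonneg hX fun v => ?_
  rw [Complex.le_def]
  refine ⟨by simpa [rtr_vecMulVec] using h v, ?_⟩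
  exact (hX.im_star_dotProduct_mulVec_self v).symm

lemma posDef_of_sub_smul_one {X : Matrix (Fin k) (Fin k) ℂ} {ε : ℝ} (hε : 0 < ε)
    (h : (X - ε • (1 : Matrix (Fin k) (Fin k) ℂ)).PosSemidef) : X.PosDef := by
  have h1 : (ε • (1 : Matrix (Fin k) (Fin k) ℂ)).PosDef := PosDef.one.smul hε
  simpa using h1.add_posSemidef h

/-- The inverse is the pointwise supremum of the affine maps `P ↦ 2 X - X P X`. -/
lemma inv_sub_eq {P X : Matrix (Fin k) (Fin k) ℂ} (hP : P.PosDef) :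
    P⁻¹ - (2 • X - X * P * X) = (P⁻¹ - X) * P * (P⁻¹ - X) := by
  have hu := (Matrix.isUnit_iff_isUnit_det _).1 hP.isUnit
  have h1 : P⁻¹ * P = 1 := nonsing_inv_mul _ hu
  have h2 : P * P⁻¹ = 1 := mul_nonsing_inv _ hu
  simp only [sub_mul, mul_sub, h1, one_mul]
  rw [Matrix.mul_assoc X P P⁻¹, h2, mul_one, two_smul]
  abel

lemma posSemidef_inv_sub {P X : Matrix (Fin k) (Fin k) ℂ} (hP : P.PosDef) (hX : X.IsHermitian) :
    (P⁻¹ - (2 • X - X * P * X)).PosSemidef := by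
  rw [inv_sub_eq hP]
  have h : (P⁻¹ - X).IsHermitian := hP.inv.1.sub hX
  have := hP.posSemidef.conjTranspose_mul_mul_same (P⁻¹ - X)
  rwa [h.eq] at this

lemma rtr_mul_mono {X Y W : Matrix (Fin k) (Fin k) ℂ} (h : (Y - X).PosSemidef)
    (hW : W.PosSemidef) : rtr k (X * W) ≤ rtr k (Y * W) := by
  have := rtr_mul_nonneg h hW
  rw [sub_mul, map_sub] at this
  linarith

lemma abs_rtr_mul_le {X W : Matrix (Fin k) (Fin k) ℂ} (hX : X.IsHermitian)
    (hW : W.PosSemidef) : |rtr k (X * W)| ≤ ‖X‖ * rtr k W := by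
  rw [abs_le]
  constructor
  · have := rtr_mul_mono (posSemidef_norm_smul_one_sub hX.neg) hW
    simp only [neg_mul, map_neg, norm_neg, smul_mul_assoc, one_mul, map_smul, smul_eq_mul] at this
    linarith
  · have := rtr_mul_mono (posSemidef_norm_smul_one_sub hX) hW
    simpa using this

/-- If the quadratic form of `P` at the unit vector `v` is at most `a`, then
`tr P⁻¹ ≥ 1 / a`. -/
lemma inv_le_rtr_inv {P : Matrix (Fin k) (Fin k) ℂ} (hP : P.PosDef) {v : Fin k → ℂ}
    (hv : rtr k (vecMulVec v (star v)) = 1) {a : ℝ} (ha : 0 < a)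
    (h : rtr k (P * vecMulVec v (star v)) ≤ a) : a⁻¹ ≤ rtr k P⁻¹ := by
  set W := vecMulVec v (star v) with hW
  have hWh : W.IsHermitian := (posSemidef_vecMulVec_self_star v).1
  have hdot : star v ⬝ᵥ v = 1 := by
    have h1 : (star v ⬝ᵥ v).re = 1 := by
      have := rtr_vecMulVec (1 : Matrix (Fin k) (Fin k) ℂ) v
      rw [one_mul, one_mulVec] at this
      rw [← this, hv]
    have h2 : (star v ⬝ᵥ v).im = 0 := by
      have := (Complex.le_def.1 (dotProduct_star_self_nonneg v)).2
      simpa [dotProduct_comm] using this.symm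
    exact Complex.ext h1 h2
  have hWW : W * W = W := by
    rw [hW, vecMulVec_mul_vecMulVec, hdot]
    simp
  -- The choice X = a⁻¹vv* in the affine bound gives tr P⁻¹ ≥ 2/a - a⁻² v*Pv ≥ 1/a.
  have hX : (a⁻¹ • W).IsHermitian := by
    unfold Matrix.IsHermitian
    rw [conjTranspose_smul, hWh.eq, star_trivial]
  have key := rtr_nonneg (posSemidef_inv_sub hP hX)
  have h3 : rtr k (W * P * W) = rtr k (P * W) := by
    rw [Matrix.mul_assoc, rtr_mul_comm, Matrix.mul_assoc, hWW]
  simp only [map_sub, map_smul, smul_mul_assoc, mul_smul_comm, smul_eq_mul, h3, hv, two_smul,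
    map_add] at key
  have : a⁻¹ * (a⁻¹ * rtr k (P * W)) ≤ a⁻¹ := by
    have : a⁻¹ * rtr k (P * W) ≤ 1 := by
      rw [inv_mul_le_iff₀ ha]; linarith
    calc a⁻¹ * (a⁻¹ * rtr k (P * W)) ≤ a⁻¹ * 1 := by gcongr
      _ = a⁻¹ := mul_one _
  linarith

/-- A bound on the inverse of a positive definite matrix is a lower bound for the matrix. -/
lemma posSemidef_sub_inv_smul_one {P : Matrix (Fin k) (Fin k) ℂ} (hP : P.PosDef) {M : ℝ}
    (hM : 0 < M) (h : ‖P⁻¹‖ ≤ M) :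
    (P - M⁻¹ • (1 : Matrix (Fin k) (Fin k) ℂ)).PosSemidef := by
  -- The affine bound for the inverse of P⁻¹ at X = M⁻¹I gives P ≥ 2M⁻¹I - M⁻²P⁻¹, and P⁻¹ ≤ MI.
  have hX : (M⁻¹ • (1 : Matrix (Fin k) (Fin k) ℂ)).IsHermitian := by
    unfold Matrix.IsHermitian
    rw [conjTranspose_smul, conjTranspose_one, star_trivial]
  have h1 := posSemidef_inv_sub hP.inv hX
  rw [nonsing_inv_nonsing_inv _ ((Matrix.isUnit_iff_isUnit_det _).1 hP.isUnit)] at h1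
  have h2 := (posSemidef_norm_smul_one_sub hP.inv.1).smul (a := M⁻¹ * M⁻¹) (by positivity)
  have h3 : ((M⁻¹ - M⁻¹ * M⁻¹ * ‖P⁻¹‖) • (1 : Matrix (Fin k) (Fin k) ℂ)).PosSemidef := by
    refine PosSemidef.one.smul ?_
    have : M⁻¹ * ‖P⁻¹‖ ≤ 1 := by rw [inv_mul_le_iff₀ hM]; linarith
    nlinarith [inv_pos.2 hM]
  have := (h1.add h2).add h3
  convert this using 1
  simp only [smul_mul_assoc, mul_smul_comm, one_mul, mul_one, smul_sub, smul_smul, sub_smul,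
    two_smul]
  abel

end MatrixTrace

instance fact_two_pi_pos : Fact (0 < 2 * Real.pi) := ⟨Real.two_pi_pos⟩

lemma integrable_of_continuous {E : Type*} [NormedAddCommGroup E] {f : CircleAngle → E}
    (hf : Continuous f) : Integrable f circleMeasure :=
  hf.integrable_of_hasCompactSupport (HasCompactSupport.of_compactSpace f)

/-! ### The resolvent of a stable matrix on the unit circle. -/

section Resolvent

variable {n m : ℕ} {A : Matrix (Fin n) (Fin n) ℂ}

lemma IsStable.isUnit_sub (hA : IsStable A) {z : ℂ} (hz : 1 ≤ ‖z‖) :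
    IsUnit (z • (1 : Matrix (Fin n) (Fin n) ℂ) - A) := by
  have h : z ∉ spectrum ℂ A := fun h => not_lt.2 hz (hA z h)
  rwa [spectrum.notMem_iff, Algebra.algebraMap_eq_smul_one] at h

lemma norm_toCircle (θ : CircleAngle) : ‖(AddCircle.toCircle θ : ℂ)‖ = 1 := Circle.norm_coe _

lemma IsStable.isUnit_circle (hA : IsStable A) (θ : CircleAngle) :
    IsUnit ((AddCircle.toCircle θ : ℂ) • (1 : Matrix (Fin n) (Fin n) ℂ) - A) :=
  hA.isUnit_sub (norm_toCircle θ).ge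

lemma continuous_coe_toCircle : Continuous fun θ : CircleAngle => (AddCircle.toCircle θ : ℂ) :=
  continuous_subtype_val.comp AddCircle.continuous_toCircle

lemma continuous_inv_of_isUnit {X : Type*} [TopologicalSpace X]
    {f : X → Matrix (Fin n) (Fin n) ℂ} (hf : Continuous f) (hu : ∀ x, IsUnit (f x)) :
    Continuous fun x => (f x)⁻¹ := by
  simp only [nonsing_inv_eq_ringInverse]
  refine continuous_iff_continuousAt.2 fun x => ?_
  obtain ⟨u, hu⟩ := hu x
  have := NormedRing.inverse_continuousAt u
  rw [hu] at this
  exact this.comp hf.continuousAt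

lemma IsStable.continuous_resolvent (hA : IsStable A) :
    Continuous fun θ : CircleAngle =>
      ((AddCircle.toCircle θ : ℂ) • (1 : Matrix (Fin n) (Fin n) ℂ) - A)⁻¹ :=
  continuous_inv_of_isUnit ((continuous_coe_toCircle.smul continuous_const).sub continuous_const)
    hA.isUnit_circle

lemma IsStable.continuous_transfer (hA : IsStable A) (B : Matrix (Fin n) (Fin m) ℂ) :
    Continuous (transfer A B) :=
  hA.continuous_resolvent.matrix_mul continuous_const

lemma IsStable.exists_norm_resolvent_le (hA : IsStable A) :
    ∃ M : ℝ, 0 < M ∧ ∀ θ : CircleAngle,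
      ‖((AddCircle.toCircle θ : ℂ) • (1 : Matrix (Fin n) (Fin n) ℂ) - A)⁻¹‖ ≤ M := by
  obtain ⟨M, hM⟩ := isCompact_univ.exists_bound_of_continuousOn
    hA.continuous_resolvent.continuousOn
  exact ⟨max M 1, by positivity, fun θ => (hM θ trivial).trans (le_max_left _ _)⟩

/-- Gelfand's formula: the spectral radius lies below some r < 1, so eventually ‖Aᵏ‖ < rᵏ. -/
lemma IsStable.tendsto_pow (hA : IsStable A) :
    Filter.Tendsto (fun k : ℕ => A ^ k) Filter.atTop (nhds 0) := by
  rcases n.eq_zero_or_pos with rfl | hn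
  · have : ∀ k : ℕ, A ^ k = 0 := fun k => Subsingleton.elim _ _
    simp [this]
  have : Nonempty (Fin n) := ⟨⟨0, hn⟩⟩
  have h1 : spectralRadius ℂ A < ((1 : NNReal) : ℝ≥0∞) :=
    spectrum.spectralRadius_lt_of_forall_lt A fun z hz => hA z hz
  obtain ⟨r, hr, hr1⟩ := ENNReal.lt_iff_exists_nnreal_btwn.1 h1
  have h2 := spectrum.pow_nnnorm_pow_one_div_tendsto_nhds_spectralRadius A
  have h3 := h2.eventually_lt_const hr
  have hr1' : (r : ℝ) < 1 := by exact_mod_cast hr1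
  refine squeeze_zero_norm' ?_ (tendsto_pow_atTop_nhds_zero_of_lt_one r.2 hr1')
  filter_upwards [h3, Filter.eventually_gt_atTop 0] with k hk hk0
  have hk0' : (0 : ℝ) < k := by exact_mod_cast hk0
  have h4 := ENNReal.rpow_le_rpow hk.le hk0'.le
  rw [← ENNReal.rpow_mul, one_div_mul_cancel hk0'.ne', ENNReal.rpow_one,
    ENNReal.rpow_natCast] at h4
  exact_mod_cast h4

lemma integral_zpow_smul_const {E : Type*} [NormedAddCommGroup E] [NormedSpace ℂ E]
    [CompleteSpace E] {j : ℤ} (hj : j ≠ 0) (c : E) :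
    ∫ θ, (AddCircle.toCircle θ : ℂ) ^ j • c ∂circleMeasure = 0 := by
  have h : ∫ θ, fourier j θ ∂circleMeasure = 0 :=
    integral_eq_zero_of_add_right_eq_neg (μ := circleMeasure)
      (fourier_add_half_inv_index hj Real.two_pi_pos)
  rw [integral_smul_const]
  simp only [fourier_apply, AddCircle.toCircle_zsmul, Circle.coe_zpow] at h
  rw [h, zero_smul]

/-- From zR = I + AR and the vanishing of the nonzero Fourier modes, ∫ z⁻ʲR = A ∫ z⁻ʲ⁻¹R. Iteration
gives ∫ R = Aʲ ∫ z⁻ʲR, whose norm is at most M‖Aʲ‖ → 0. -/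
lemma IsStable.integral_resolvent (hA : IsStable A) :
    ∫ θ, ((AddCircle.toCircle θ : ℂ) • (1 : Matrix (Fin n) (Fin n) ℂ) - A)⁻¹ ∂circleMeasure = 0 := by
  set R : CircleAngle → Matrix (Fin n) (Fin n) ℂ := fun θ =>
    ((AddCircle.toCircle θ : ℂ) • (1 : Matrix (Fin n) (Fin n) ℂ) - A)⁻¹ with hR
  have hRc : Continuous R := hA.continuous_resolvent
  have hz : ∀ θ : CircleAngle, (AddCircle.toCircle θ : ℂ) ≠ 0 := fun θ => Circle.coe_ne_zero _
  have hzc : ∀ j : ℤ, Continuous fun θ : CircleAngle => (AddCircle.toCircle θ : ℂ) ^ j :=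
    fun j => continuous_coe_toCircle.zpow₀ j fun θ => Or.inl (hz θ)
  have hstep : ∀ j : ℕ, ∫ θ, (AddCircle.toCircle θ : ℂ) ^ (-(j : ℤ)) • R θ ∂circleMeasure =
      A * ∫ θ, (AddCircle.toCircle θ : ℂ) ^ (-((j + 1 : ℕ) : ℤ)) • R θ ∂circleMeasure := by
    intro j
    have hi : Integrable (fun θ : CircleAngle =>
        (AddCircle.toCircle θ : ℂ) ^ (-((j + 1 : ℕ) : ℤ)) • R θ) circleMeasure :=
      integrable_of_continuous ((hzc _).smul hRc)
    have hi' : Integrable (fun θ : CircleAngle => (AddCircle.toCircle θ : ℂ) ^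
        (-((j + 1 : ℕ) : ℤ)) • (1 : Matrix (Fin n) (Fin n) ℂ)) circleMeasure :=
      integrable_of_continuous ((hzc _).smul continuous_const)
    rw [← integral_const_mul_of_integrable hi, ← zero_add (∫ θ, A * _ ∂circleMeasure),
      ← integral_zpow_smul_const (j := -((j + 1 : ℕ) : ℤ)) (by omega)
        (1 : Matrix (Fin n) (Fin n) ℂ),
      ← integral_add hi' (hi.const_mul A)]
    refine integral_congr_ae (Filter.Eventually.of_forall fun θ => ?_)
    have h1 : (AddCircle.toCircle θ : ℂ) • R θ = 1 + A * R θ := by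
      have := mul_nonsing_inv _ ((Matrix.isUnit_iff_isUnit_det _).1 (hA.isUnit_circle θ))
      rw [sub_mul, smul_mul_assoc, one_mul] at this
      rw [← this]
      abel
    have h2 : (AddCircle.toCircle θ : ℂ) ^ (-(j : ℤ)) =
        (AddCircle.toCircle θ : ℂ) ^ (-((j + 1 : ℕ) : ℤ)) * AddCircle.toCircle θ := by
      rw [← zpow_add_one₀ (hz θ)]
      congr 1
      push_cast
      ring
    simp only
    rw [h2, mul_smul, h1, smul_add, mul_smul_comm]
  have hpow : ∀ j : ℕ, ∫ θ, R θ ∂circleMeasure =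
      A ^ j * ∫ θ, (AddCircle.toCircle θ : ℂ) ^ (-(j : ℤ)) • R θ ∂circleMeasure := by
    intro j
    induction j with
    | zero => simp
    | succ j ih => rw [ih, hstep, pow_succ, Matrix.mul_assoc]
  obtain ⟨M, hM0, hM⟩ := hA.exists_norm_resolvent_le
  have hlim : Filter.Tendsto (fun j : ℕ => ‖A ^ j‖ * M) Filter.atTop (nhds 0) := by
    simpa using hA.tendsto_pow.norm.mul_const M
  refine norm_le_zero_iff.1 (ge_of_tendsto' hlim fun j => ?_)
  rw [hpow j]
  refine (norm_mul_le _ _).trans (mul_le_mul_of_nonneg_left ?_ (norm_nonneg _))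
  refine (norm_integral_le_of_norm_le_const (C := M) (Filter.Eventually.of_forall fun θ => ?_)).trans
    (by simp)
  rw [norm_smul, norm_zpow, norm_toCircle, _root_.one_zpow, one_mul]
  exact hM θ

end Resolvent

/-! ### Positive definite preimages under Γ, through Stein equations. -/

section Preimage

variable {n m : ℕ} {A : Matrix (Fin n) (Fin n) ℂ} {B : Matrix (Fin n) (Fin m) ℂ}

lemma IsStable.sub_mul_transfer (hA : IsStable A) (B : Matrix (Fin n) (Fin m) ℂ)
    (θ : CircleAngle) :
    ((AddCircle.toCircle θ : ℂ) • (1 : Matrix (Fin n) (Fin n) ℂ) - A) * transfer A B θ = B := by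
  rw [transfer, ← Matrix.mul_assoc,
    mul_nonsing_inv _ ((Matrix.isUnit_iff_isUnit_det _).1 (hA.isUnit_circle θ)), Matrix.one_mul]

lemma IsStable.mul_transfer (hA : IsStable A) (B : Matrix (Fin n) (Fin m) ℂ) (θ : CircleAngle) :
    A * transfer A B θ = (AddCircle.toCircle θ : ℂ) • transfer A B θ - B := by
  have := hA.sub_mul_transfer B θ
  rw [Matrix.sub_mul, Matrix.smul_mul, Matrix.one_mul] at this
  exact eq_sub_of_add_eq (sub_eq_iff_eq_add'.1 this).symm

lemma mulVec_injective_of_rank_eq (hB : B.rank = m) : Function.Injective B.mulVec := by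
  have h1 := LinearMap.finrank_range_add_finrank_ker B.mulVecLin
  have h2 : Module.finrank ℂ (LinearMap.range B.mulVecLin) = m := hB
  rw [h2, Module.finrank_fin_fun] at h1
  have h3 : LinearMap.ker B.mulVecLin = ⊥ := Submodule.finrank_eq_zero.1 (by omega)
  exact LinearMap.ker_eq_bot.1 h3

lemma toCircle_mul_star (θ : CircleAngle) :
    (AddCircle.toCircle θ : ℂ) * star (AddCircle.toCircle θ : ℂ) = 1 := by
  rw [Complex.star_def, Complex.mul_conj, Complex.normSq_eq_norm_sq, norm_toCircle]
  simp

/-- If `P` annihilates `B`, then `P Σ P* = (P A) Σ (P A)*` for every `Σ` in the range of `Γ`. -/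
lemma IsStable.conj_rangeGamma (hA : IsStable A) {P S : Matrix (Fin n) (Fin n) ℂ}
    (hP : P * B = 0) (hS : S ∈ rangeGamma A B) : P * S * Pᴴ = P * A * S * (P * A)ᴴ := by
  obtain ⟨Φ, hΦ, -, rfl⟩ := hS
  have hi : Integrable (fun θ => transfer A B θ * Φ θ * (transfer A B θ)ᴴ) circleMeasure :=
    integrable_of_continuous (((hA.continuous_transfer B).matrix_mul hΦ).matrix_mul
      (hA.continuous_transfer B).matrix_conjTranspose)
  have hpull : ∀ L R : Matrix (Fin n) (Fin n) ℂ, L * gammaOp A B Φ * R =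
      ∫ θ, L * (transfer A B θ * Φ θ * (transfer A B θ)ᴴ) * R ∂circleMeasure := by
    intro L R
    rw [integral_mul_const_of_integrable (hi.const_mul L), integral_const_mul_of_integrable hi]
    rfl
  rw [hpull, hpull]
  refine integral_congr_ae (Filter.Eventually.of_forall fun θ => ?_)
  set G := transfer A B θ with hG
  set z : ℂ := (AddCircle.toCircle θ : ℂ) with hz
  -- AG = zG - B and PB = 0, so PA acts on G as zP; the unimodular factor cancels in the
  -- conjugation.
  have h1 : P * A * G = z • (P * G) := by
    rw [Matrix.mul_assoc, hA.mul_transfer B θ, Matrix.mul_sub, hP, sub_zero, Matrix.mul_smul]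
  have h2 : P * A * (G * Φ θ * Gᴴ) * (P * A)ᴴ = (P * A * G) * Φ θ * (P * A * G)ᴴ := by
    rw [conjTranspose_mul (P * A) G]
    simp only [Matrix.mul_assoc]
  have h3 : P * (G * Φ θ * Gᴴ) * Pᴴ = (P * G) * Φ θ * (P * G)ᴴ := by
    rw [conjTranspose_mul P G]
    simp only [Matrix.mul_assoc]
  simp only
  rw [h2, h3, h1, conjTranspose_smul]
  simp only [Matrix.smul_mul, Matrix.mul_smul, smul_smul]
  rw [mul_comm, toCircle_mul_star, one_smul]

/-- A Stein equation with positive definite solution and right-hand side `B M B*` makes `P A`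
stable, if `A` is and `P` is a perturbation of the identity by left multiples of `B`. -/
lemma isStable_of_stein (hA : IsStable A) {S : Matrix (Fin n) (Fin n) ℂ} (hS : S.PosDef)
    {M : Matrix (Fin m) (Fin m) ℂ} (hM : M.PosDef) {C : Matrix (Fin m) (Fin n) ℂ}
    (h : S - (1 - B * C) * A * S * ((1 - B * C) * A)ᴴ = B * M * Bᴴ) :
    IsStable ((1 - B * C) * A) := by
  set A' := (1 - B * C) * A with hA'
  intro μ hμ
  by_contra! hμ1
  have hnot : ¬ IsUnit (μ • (1 : Matrix (Fin n) (Fin n) ℂ) - A') := by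
    rwa [← Algebra.algebraMap_eq_smul_one, ← spectrum.mem_iff]
  rw [← vecMul_injective_iff_isUnit] at hnot
  obtain ⟨w, hw0, hw⟩ : ∃ w : Fin n → ℂ, w ≠ 0 ∧
      w ᵥ* (μ • (1 : Matrix (Fin n) (Fin n) ℂ) - A') = 0 := by
    simp only [Function.Injective, not_forall] at hnot
    obtain ⟨x, y, hxy, hne⟩ := hnot
    exact ⟨x - y, sub_ne_zero.2 hne, by rw [sub_vecMul]; exact sub_eq_zero.2 hxy⟩
  have hwA : w ᵥ* A' = μ • w := by
    rw [vecMul_sub, vecMul_smul, vecMul_one, sub_eq_zero] at hw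
    exact hw.symm
  have hquad : ∀ {l : ℕ} (X : Matrix (Fin n) (Fin l) ℂ) (Y : Matrix (Fin l) (Fin l) ℂ),
      w ⬝ᵥ (X * Y * Xᴴ) *ᵥ star w = (w ᵥ* X) ⬝ᵥ Y *ᵥ star (w ᵥ* X) := by
    intro l X Y
    rw [star_vecMul, ← mulVec_mulVec, ← mulVec_mulVec, dotProduct_mulVec w X]
  -- Tested on a left eigenvector w, the Stein equation reads (1 - |μ|²) wSw* = (wB)M(wB)*. If |μ| ≥
  -- 1, the left side is at most 0, so wB = 0; then w is a left eigenvector of A itself, against its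
  -- stability.
  have key := congrArg (fun X => (w ⬝ᵥ X *ᵥ star w).re) h
  simp only [sub_mulVec, dotProduct_sub, hquad, hwA] at key
  have hswne : star w ≠ 0 := by simpa using hw0
  have hSpos : 0 < (w ⬝ᵥ S *ᵥ star w).re := by
    have := (Complex.lt_def.1 (hS.dotProduct_mulVec_pos hswne)).1
    simpa using this
  have h1 : (μ • w) ⬝ᵥ S *ᵥ star (μ • w) = ((‖μ‖ ^ 2 : ℝ) : ℂ) * (w ⬝ᵥ S *ᵥ star w) := by
    rw [star_smul, mulVec_smul, smul_dotProduct, dotProduct_smul, smul_eq_mul, smul_eq_mul,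
      ← mul_assoc, Complex.star_def, Complex.mul_conj, Complex.normSq_eq_norm_sq]
  rw [h1, Complex.sub_re, Complex.re_ofReal_mul] at key
  have hwB : w ᵥ* B = 0 := by
    by_contra hne
    have hsne : star (w ᵥ* B) ≠ 0 := by simpa using hne
    have hMpos : 0 < ((w ᵥ* B) ⬝ᵥ M *ᵥ star (w ᵥ* B)).re := by
      have := (Complex.lt_def.1 (hM.dotProduct_mulVec_pos hsne)).1
      simpa using this
    nlinarith [one_le_pow₀ hμ1 (n := 2)]
  have hwA2 : w ᵥ* A = μ • w := by
    rw [← hwA, hA', ← vecMul_vecMul, vecMul_sub, vecMul_one, ← vecMul_vecMul, hwB, zero_vecMul,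
      sub_zero]
  have hu := hA.isUnit_sub hμ1
  rw [← vecMul_injective_iff_isUnit] at hu
  refine hw0 (hu ?_)
  simp only
  rw [vecMul_sub, vecMul_smul, vecMul_one, hwA2, sub_self, zero_vecMul]

/-- A stable Stein equation, written as an integral over the circle. -/
lemma IsStable.integral_stein (hA : IsStable A) {S D : Matrix (Fin n) (Fin n) ℂ}
    (h : S - A * S * Aᴴ = D) :
    ∫ θ, ((AddCircle.toCircle θ : ℂ) • (1 : Matrix (Fin n) (Fin n) ℂ) - A)⁻¹ * D *
      (((AddCircle.toCircle θ : ℂ) • (1 : Matrix (Fin n) (Fin n) ℂ) - A)⁻¹)ᴴ ∂circleMeasure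
      = S := by
  set R : CircleAngle → Matrix (Fin n) (Fin n) ℂ := fun θ =>
    ((AddCircle.toCircle θ : ℂ) • (1 : Matrix (Fin n) (Fin n) ℂ) - A)⁻¹ with hR
  have hRc : Continuous R := hA.continuous_resolvent
  have hR0 : ∫ θ, R θ ∂circleMeasure = 0 := hA.integral_resolvent
  have hRi : Integrable R circleMeasure := integrable_of_continuous hRc
  have hRH : ∫ θ, (R θ)ᴴ ∂circleMeasure = 0 := by
    have := (starL' ℝ (A := Matrix (Fin n) (Fin n) ℂ)).toContinuousLinearMap.integral_comp_comm hRi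
    rw [hR0, map_zero] at this
    exact this
  have hRHi : Integrable (fun θ => (R θ)ᴴ) circleMeasure :=
    integrable_of_continuous hRc.matrix_conjTranspose
  -- With Z = zI - A and |z| = 1, D = ZSZ* + ZSA* + ASZ*. After conjugation by R = Z⁻¹ only S and
  -- terms with a single resolvent remain, and the latter integrate to 0.
  have hpt : ∀ θ, R θ * D * (R θ)ᴴ = S + S * Aᴴ * (R θ)ᴴ + R θ * (A * S) := by
    intro θ
    set z : ℂ := (AddCircle.toCircle θ : ℂ) with hz
    have hu := (Matrix.isUnit_iff_isUnit_det _).1 (hA.isUnit_circle θ)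
    have h1 : R θ * (z • (1 : Matrix (Fin n) (Fin n) ℂ) - A) = 1 := nonsing_inv_mul _ hu
    have h2 : (z • (1 : Matrix (Fin n) (Fin n) ℂ) - A)ᴴ * (R θ)ᴴ = 1 := by
      rw [← conjTranspose_mul, h1, conjTranspose_one]
    have hzz : z * star z = 1 := toCircle_mul_star θ
    have hD : D = (z • (1 : Matrix (Fin n) (Fin n) ℂ) - A) * S *
          (z • (1 : Matrix (Fin n) (Fin n) ℂ) - A)ᴴ +
        (z • (1 : Matrix (Fin n) (Fin n) ℂ) - A) * S * Aᴴ +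
        A * S * (z • (1 : Matrix (Fin n) (Fin n) ℂ) - A)ᴴ := by
      rw [← h, conjTranspose_sub, conjTranspose_smul, conjTranspose_one]
      simp only [sub_mul, mul_sub, smul_mul_assoc, mul_smul_comm, one_mul, mul_one, smul_smul,
        smul_sub, mul_comm (star z) z, hzz, one_smul]
      abel
    set Z := z • (1 : Matrix (Fin n) (Fin n) ℂ) - A with hZ
    calc R θ * D * (R θ)ᴴ = (R θ * Z) * S * (Zᴴ * (R θ)ᴴ) + (R θ * Z) * S * Aᴴ * (R θ)ᴴ +
          R θ * (A * S) * (Zᴴ * (R θ)ᴴ) := by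
          rw [hD]
          simp only [mul_add, add_mul, Matrix.mul_assoc]
      _ = _ := by rw [h1, h2, one_mul, mul_one, mul_one]
  calc ∫ θ, R θ * D * (R θ)ᴴ ∂circleMeasure
      = ∫ θ, (S + S * Aᴴ * (R θ)ᴴ + R θ * (A * S)) ∂circleMeasure := by simp only [hpt]
    _ = S := by
        have h1 : Integrable (fun θ => S + S * Aᴴ * (R θ)ᴴ) circleMeasure :=
          (integrable_const S).add (hRHi.const_mul _)
        rw [integral_add h1 (hRi.mul_const _),
          integral_add (integrable_const S) (hRHi.const_mul _),
          integral_const_mul_of_integrable hRHi, integral_mul_const_of_integrable hRi, hRH, hR0]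
        simp

/-- Every positive definite element of the range of `Γ` is the image of a positive definite
continuous function. -/
lemma exists_posDef_preimage (hA : IsStable A) (hB : B.rank = m) {S : Matrix (Fin n) (Fin n) ℂ}
    (hS : S ∈ PGamma A B) :
    ∃ Φ : CircleAngle → Matrix (Fin m) (Fin m) ℂ,
      Continuous Φ ∧ (∀ θ, (Φ θ).PosDef) ∧ gammaOp A B Φ = S := by
  obtain ⟨hSr, hSp⟩ := hS
  have hBinj := mulVec_injective_of_rank_eq hB
  -- With C = N⁻¹B*S⁻¹, the matrix I - BC is the projection killing B along the S⁻¹-orthogonal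
  -- complement decomposition, which gives the Stein equation S - A'SA'* = BMB* for A' = (I - BC)A.
  set N := Bᴴ * S⁻¹ * B with hN
  have hNp : N.PosDef := hSp.inv.conjTranspose_mul_mul_same hBinj
  have hNu := (Matrix.isUnit_iff_isUnit_det _).1 hNp.isUnit
  have hSu := (Matrix.isUnit_iff_isUnit_det _).1 hSp.isUnit
  set M := N⁻¹ with hM
  have hMp : M.PosDef := hNp.inv
  have hMN : M * N = 1 := nonsing_inv_mul _ hNu
  set C := M * Bᴴ * S⁻¹ with hC
  have hSiS : S⁻¹ * S = 1 := nonsing_inv_mul _ hSu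
  have hCB : C * B = 1 := by rw [hC, ← hMN, hN]; simp only [Matrix.mul_assoc]
  have hPB : (1 - B * C) * B = 0 := by
    rw [Matrix.sub_mul, Matrix.one_mul, Matrix.mul_assoc, hCB, Matrix.mul_one, sub_self]
  have hCS : C * S = M * Bᴴ := by rw [hC, Matrix.mul_assoc, hSiS, Matrix.mul_one]
  have hSC : S * Cᴴ = B * M := by
    have := congrArg conjTranspose hCS
    rwa [conjTranspose_mul C S, conjTranspose_mul M, hSp.1.eq, hMp.1.eq, conjTranspose_conjTranspose]
      at this
  have hPS : (1 - B * C) * S * (1 - B * C)ᴴ = S - B * M * Bᴴ := by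
    have h1 : (1 - B * C) * S = S - B * M * Bᴴ := by
      rw [Matrix.sub_mul, Matrix.one_mul, Matrix.mul_assoc, hCS, Matrix.mul_assoc]
    have h2 : S * (1 - B * C)ᴴ = S - B * M * Bᴴ := by
      rw [conjTranspose_sub, conjTranspose_one, conjTranspose_mul, Matrix.mul_sub, Matrix.mul_one,
        ← Matrix.mul_assoc, hSC]
    rw [Matrix.mul_assoc, h2, Matrix.mul_sub, h1, ← Matrix.mul_assoc, ← Matrix.mul_assoc, hPB,
      Matrix.zero_mul, Matrix.zero_mul, sub_zero]
  set A' := (1 - B * C) * A with hA'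
  have hst : S - A' * S * A'ᴴ = B * M * Bᴴ := by
    rw [hA', ← hA.conj_rangeGamma hPB hSr, hPS]
    abel
  have hA's : IsStable A' := isStable_of_stein hA hSp hMp hst
  set W : CircleAngle → Matrix (Fin m) (Fin m) ℂ := fun θ => Bᴴ * S⁻¹ * transfer A B θ with hW
  have hWc : Continuous W := continuous_const.matrix_mul (hA.continuous_transfer B)
  have hMW : ∀ θ, M * W θ = C * transfer A B θ := fun θ => by
    simp only [hW, hC, Matrix.mul_assoc]
  have hid : ∀ θ, ((AddCircle.toCircle θ : ℂ) • (1 : Matrix (Fin n) (Fin n) ℂ) - A') *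
      transfer A B θ = (AddCircle.toCircle θ : ℂ) • (B * (M * W θ)) := by
    intro θ
    have h1 : A' * transfer A B θ = (AddCircle.toCircle θ : ℂ) • ((1 - B * C) * transfer A B θ) := by
      rw [hA', Matrix.mul_assoc, hA.mul_transfer B θ, Matrix.mul_sub, hPB, sub_zero,
        Matrix.mul_smul]
    rw [Matrix.sub_mul, h1, Matrix.smul_mul, Matrix.one_mul, ← smul_sub, hMW, Matrix.sub_mul,
      Matrix.one_mul, sub_sub_cancel, Matrix.mul_assoc]
  -- Wv = 0 forces (zI - A')Gv = 0, hence Gv = 0 by stability of A', hence Bv = (zI - A)Gv = 0 and v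
  -- = 0.
  have hWu : ∀ θ, IsUnit (W θ) := by
    intro θ
    rw [← mulVec_injective_iff_isUnit]
    refine (injective_iff_map_eq_zero (W θ).mulVecLin).2 fun v hv => ?_
    have hv' : W θ *ᵥ v = 0 := hv
    have h1 := congrArg (fun X => X *ᵥ v) (hid θ)
    simp only [smul_mulVec, ← mulVec_mulVec, hv', mulVec_zero, smul_zero] at h1
    have h2 : transfer A B θ *ᵥ v = 0 :=
      (mulVec_injective_iff_isUnit.2 (hA's.isUnit_circle θ)) (by rw [mulVec_zero]; exact h1)
    have h3 := congrArg (fun X => X *ᵥ v) (hA.sub_mul_transfer B θ)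
    simp only [← mulVec_mulVec, h2, mulVec_zero] at h3
    exact hBinj (by rw [mulVec_zero]; exact h3.symm)
  have hWic : Continuous fun θ => (W θ)⁻¹ := continuous_inv_of_isUnit hWc hWu
  refine ⟨fun θ => (W θ)⁻¹ * N * ((W θ)⁻¹)ᴴ,
    (hWic.matrix_mul continuous_const).matrix_mul hWic.matrix_conjTranspose, fun θ => ?_, ?_⟩
  · refine (IsUnit.posDef_star_right_conjugate_iff ?_).2 hNp
    exact (isUnit_nonsing_inv_iff).2 (hWu θ)
  · rw [gammaOp, ← hA's.integral_stein hst]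
    refine integral_congr_ae (Filter.Eventually.of_forall fun θ => ?_)
    simp only
    set R := ((AddCircle.toCircle θ : ℂ) • (1 : Matrix (Fin n) (Fin n) ℂ) - A')⁻¹ with hR
    set z : ℂ := (AddCircle.toCircle θ : ℂ) with hz
    -- The integrand thus becomes RBMNMB*R* = RBMB*R*, the one in the Stein integral for A'.
    have hGW : transfer A B θ * (W θ)⁻¹ = z • (R * B * M) := by
      have h1 : transfer A B θ = R * (z • (B * (M * W θ))) := by
        rw [← hid θ, ← Matrix.mul_assoc,
          nonsing_inv_mul _ ((Matrix.isUnit_iff_isUnit_det _).1 (hA's.isUnit_circle θ)),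
          Matrix.one_mul]
      rw [h1, Matrix.mul_smul, Matrix.smul_mul]
      congr 1
      simp only [Matrix.mul_assoc]
      rw [mul_nonsing_inv _ ((Matrix.isUnit_iff_isUnit_det _).1 (hWu θ)), Matrix.mul_one]
    have h2 : transfer A B θ * ((W θ)⁻¹ * N * ((W θ)⁻¹)ᴴ) * (transfer A B θ)ᴴ =
        (transfer A B θ * (W θ)⁻¹) * N * (transfer A B θ * (W θ)⁻¹)ᴴ := by
      rw [conjTranspose_mul (transfer A B θ)]
      simp only [Matrix.mul_assoc]
    rw [h2, hGW, conjTranspose_smul, conjTranspose_mul, conjTranspose_mul, hMp.1.eq]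
    simp only [Matrix.smul_mul, Matrix.mul_smul, smul_smul]
    rw [mul_comm, toCircle_mul_star, one_smul]
    have h3 : R * B * M * N = R * B := by rw [Matrix.mul_assoc, hMN, Matrix.mul_one]
    rw [h3]
    simp only [Matrix.mul_assoc]

end Preimage

/-! ### The operator Γ and its adjoint Λ ↦ G*ΛG. -/

section Gamma

variable {n m : ℕ} {A : Matrix (Fin n) (Fin n) ℂ}

/-- `Γ` as a real-linear map on the continuous matrix-valued functions. -/
def gammaLinearMap (hA : IsStable A) (B : Matrix (Fin n) (Fin m) ℂ) :
    C(CircleAngle, Matrix (Fin m) (Fin m) ℂ) →ₗ[ℝ] Matrix (Fin n) (Fin n) ℂ where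
  toFun Φ := gammaOp A B Φ
  map_add' Φ Φ' := by
    have h : ∀ Φ : C(CircleAngle, Matrix (Fin m) (Fin m) ℂ),
        Integrable (fun θ => transfer A B θ * Φ θ * (transfer A B θ)ᴴ) circleMeasure := fun Φ =>
      integrable_of_continuous (((hA.continuous_transfer B).matrix_mul Φ.continuous).matrix_mul
        (hA.continuous_transfer B).matrix_conjTranspose)
    rw [gammaOp, gammaOp, gammaOp, ← integral_add (h Φ) (h Φ')]
    simp only [ContinuousMap.add_apply, Matrix.mul_add, Matrix.add_mul]
  map_smul' r Φ := by
    rw [gammaOp, gammaOp, RingHom.id_apply, ← integral_smul]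
    simp only [ContinuousMap.smul_apply, Matrix.mul_smul, Matrix.smul_mul]

/-- The real vector space of continuous Hermitian-valued functions on the circle. -/
def hermitianMaps (m : ℕ) : Submodule ℝ C(CircleAngle, Matrix (Fin m) (Fin m) ℂ) where
  carrier := {Φ | ∀ θ, (Φ θ).IsHermitian}
  add_mem' h h' θ := (h θ).add (h' θ)
  zero_mem' _ := isHermitian_zero
  smul_mem' r Φ h θ := by
    have := (h θ).eq
    simp [Matrix.IsHermitian, conjTranspose_smul, this]

/-- The range of `Γ` as a real vector space. -/
def gammaRange (hA : IsStable A) (B : Matrix (Fin n) (Fin m) ℂ) :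
    Submodule ℝ (Matrix (Fin n) (Fin n) ℂ) :=
  (hermitianMaps m).map (gammaLinearMap hA B)

lemma mem_gammaRange (hA : IsStable A) {B : Matrix (Fin n) (Fin m) ℂ}
    {S : Matrix (Fin n) (Fin n) ℂ} : S ∈ gammaRange hA B ↔ S ∈ rangeGamma A B := by
  constructor
  · rintro ⟨Φ, hΦ, rfl⟩
    exact ⟨Φ, Φ.continuous, hΦ, rfl⟩
  · rintro ⟨Φ, hc, hh, rfl⟩
    exact ⟨⟨Φ, hc⟩, hh, rfl⟩

lemma isHermitian_of_mem_rangeGamma {B : Matrix (Fin n) (Fin m) ℂ}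
    {S : Matrix (Fin n) (Fin n) ℂ} (hS : S ∈ rangeGamma A B) : S.IsHermitian := by
  obtain ⟨Φ, -, hh, rfl⟩ := hS
  have h := (starL' ℝ (A := Matrix (Fin n) (Fin n) ℂ)).integral_comp_comm
    (μ := circleMeasure) (fun θ => transfer A B θ * Φ θ * (transfer A B θ)ᴴ)
  refine h.symm.trans (integral_congr_ae (Filter.Eventually.of_forall fun θ => ?_))
  exact isHermitian_mul_mul_conjTranspose _ (hh θ)

/-- The map `Λ ↦ G* Λ G` into the continuous matrix-valued functions. -/
def compression (hA : IsStable A) (B : Matrix (Fin n) (Fin m) ℂ) :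
    Matrix (Fin n) (Fin n) ℂ →L[ℝ] C(CircleAngle, Matrix (Fin m) (Fin m) ℂ) :=
  LinearMap.toContinuousLinearMap
    { toFun := fun Λ => ⟨fun θ => (transfer A B θ)ᴴ * Λ * transfer A B θ,
        ((hA.continuous_transfer B).matrix_conjTranspose.matrix_mul
          continuous_const).matrix_mul (hA.continuous_transfer B)⟩
      map_add' := fun Λ Λ' => by
        ext1 θ
        simp [Matrix.mul_add, Matrix.add_mul]
      map_smul' := fun r Λ => by
        ext1 θ
        simp }

lemma compression_apply (hA : IsStable A) (B : Matrix (Fin n) (Fin m) ℂ)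
    (Λ : Matrix (Fin n) (Fin n) ℂ) (θ : CircleAngle) :
    compression hA B Λ θ = (transfer A B θ)ᴴ * Λ * transfer A B θ := rfl

lemma one_add_compression_apply (hA : IsStable A) (B : Matrix (Fin n) (Fin m) ℂ)
    (Λ : Matrix (Fin n) (Fin n) ℂ) (θ : CircleAngle) :
    (1 + compression hA B Λ) θ = Q A B Λ θ := rfl

lemma isHermitian_compression (hA : IsStable A) (B : Matrix (Fin n) (Fin m) ℂ)
    {Λ : Matrix (Fin n) (Fin n) ℂ} (h : Λ.IsHermitian) (θ : CircleAngle) :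
    (compression hA B Λ θ).IsHermitian :=
  isHermitian_conjTranspose_mul_mul _ h

/-- Cyclicity of the trace under the integral: `compression` is the adjoint of Γ for the trace
pairings. -/
lemma rtr_mul_gammaOp (hA : IsStable A) (B : Matrix (Fin n) (Fin m) ℂ)
    (Λ : Matrix (Fin n) (Fin n) ℂ) {Φ : CircleAngle → Matrix (Fin m) (Fin m) ℂ}
    (hΦ : Continuous Φ) :
    rtr n (Λ * gammaOp A B Φ) = ∫ θ, rtr m (compression hA B Λ θ * Φ θ) ∂circleMeasure := by
  have hi : Integrable (fun θ => transfer A B θ * Φ θ * (transfer A B θ)ᴴ) circleMeasure :=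
    integrable_of_continuous (((hA.continuous_transfer B).matrix_mul hΦ).matrix_mul
      (hA.continuous_transfer B).matrix_conjTranspose)
  rw [gammaOp, ← integral_const_mul_of_integrable hi,
    ← (rtr n).integral_comp_comm (hi.const_mul Λ)]
  refine integral_congr_ae (Filter.Eventually.of_forall fun θ => ?_)
  simp only [compression_apply]
  rw [← Matrix.mul_assoc, rtr_mul_comm, ← Matrix.mul_assoc, ← Matrix.mul_assoc]

/-- The kernel of the adjoint is orthogonal to the range of Γ: if Λ = Γ(Φ), then tr Λ² = ∫ tr(G*ΛGΦ)
= 0. -/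
lemma compression_injOn (hA : IsStable A) {B : Matrix (Fin n) (Fin m) ℂ}
    {Λ : Matrix (Fin n) (Fin n) ℂ} (hΛ : Λ ∈ rangeGamma A B) (h : compression hA B Λ = 0) :
    Λ = 0 := by
  have hh := isHermitian_of_mem_rangeGamma hΛ
  obtain ⟨Φ, hΦ, -, hΓ⟩ := id hΛ
  have h1 := rtr_mul_gammaOp hA B Λ hΦ
  simp only [h, ContinuousMap.zero_apply, zero_mul, map_zero, integral_zero, hΓ] at h1
  have h2 := sq_norm_le_rtr Λ
  rw [hh.eq, h1] at h2
  exact norm_eq_zero.1 (mul_self_eq_zero.1 (le_antisymm h2 (mul_self_nonneg _)))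

lemma mem_LGamma_iff {hA : IsStable A} {B : Matrix (Fin n) (Fin m) ℂ}
    {Λ : Matrix (Fin n) (Fin n) ℂ} :
    Λ ∈ LGamma A B ↔ Λ ∈ gammaRange hA B ∧ ∀ θ, ((1 + compression hA B Λ) θ).PosDef := by
  rw [mem_gammaRange]
  exact ⟨fun h => ⟨h.2.2, h.2.1⟩, fun h => ⟨isHermitian_of_mem_rangeGamma h.1, h.2, h.1⟩⟩

end Gamma

/-! ### Inversion in the Banach algebra of continuous matrix functions. -/

section Inverse

variable {m : ℕ}

lemma isUnit_of_posDef {f : C(CircleAngle, Matrix (Fin m) (Fin m) ℂ)} (hf : ∀ θ, (f θ).PosDef) :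
    IsUnit f :=
  (ContinuousMap.isUnit_iff_forall_isUnit f).2 fun θ => (hf θ).isUnit

lemma inverse_apply {f : C(CircleAngle, Matrix (Fin m) (Fin m) ℂ)} (hf : IsUnit f)
    (θ : CircleAngle) : Ring.inverse f θ = (f θ)⁻¹ := by
  have h := congrArg (fun g : C(CircleAngle, Matrix (Fin m) (Fin m) ℂ) => g θ)
    (Ring.mul_inverse_cancel f hf)
  exact (inv_eq_right_inv h).symm

lemma continuousAt_inverse {f : C(CircleAngle, Matrix (Fin m) (Fin m) ℂ)} (hf : IsUnit f) :
    ContinuousAt Ring.inverse f := by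
  obtain ⟨u, rfl⟩ := hf
  exact NormedRing.inverse_continuousAt u

end Inverse

/-! ### The functional X ↦ Re tr ∫ XΨ. -/

section Density

variable {m : ℕ} {Ψ : CircleAngle → Matrix (Fin m) (Fin m) ℂ}

lemma IsSpectralDensity.exists_norm_le (hΨ : IsSpectralDensity Ψ) :
    ∃ K : ℝ, 0 ≤ K ∧ ∀ᵐ θ ∂circleMeasure, ‖Ψ θ‖ ≤ K := by
  obtain ⟨c, hc, hc'⟩ := hΨ.coercive
  obtain ⟨C, hC⟩ := hΨ.bounded
  refine ⟨max (rtr m (C • 1)) 0, le_max_right _ _, ?_⟩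
  filter_upwards [hc', hC] with θ h1 h2
  have h3 : (Ψ θ).PosSemidef := by
    have := h1.add ((PosSemidef.one (n := Fin m) (R := ℂ)).smul hc.le)
    rwa [sub_add_cancel] at this
  have h4 := rtr_nonneg h2
  rw [map_sub] at h4
  exact (norm_le_rtr h3).trans ((by linarith : _ ≤ rtr m (C • 1)).trans (le_max_left _ _))

lemma IsSpectralDensity.integrable_mul (hΨ : IsSpectralDensity Ψ)
    (X : C(CircleAngle, Matrix (Fin m) (Fin m) ℂ)) :
    Integrable (fun θ => X θ * Ψ θ) circleMeasure := by
  obtain ⟨K, hK0, hK⟩ := hΨ.exists_norm_le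
  refine Integrable.of_bound (X.continuous.aestronglyMeasurable.mul hΨ.aestronglyMeasurable)
    (‖X‖ * K) ?_
  filter_upwards [hK] with θ hθ
  exact (norm_mul_le _ _).trans (mul_le_mul (X.norm_coe_le_norm θ) hθ (norm_nonneg _)
    (norm_nonneg _))

/-- The functional `X ↦ Re tr ∫ X Ψ`. -/
def densityFunctional (hΨ : IsSpectralDensity Ψ) :
    C(CircleAngle, Matrix (Fin m) (Fin m) ℂ) →L[ℝ] ℝ :=
  LinearMap.mkContinuous
    { toFun := fun X => rtr m (∫ θ, X θ * Ψ θ ∂circleMeasure)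
      map_add' := fun X Y => by
        rw [← map_add, ← integral_add (hΨ.integrable_mul X) (hΨ.integrable_mul Y)]
        simp only [ContinuousMap.add_apply, add_mul]
      map_smul' := fun r X => by
        rw [RingHom.id_apply, ← map_smul, ← integral_smul]
        simp only [ContinuousMap.smul_apply, smul_mul_assoc] }
    (‖rtr m‖ * hΨ.exists_norm_le.choose) fun X => by
      obtain ⟨hK0, hK⟩ := hΨ.exists_norm_le.choose_spec
      refine ((rtr m).le_opNorm _).trans ?_
      rw [mul_assoc, mul_comm _ ‖X‖]
      refine mul_le_mul_of_nonneg_left ?_ (norm_nonneg _)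
      refine (norm_integral_le_of_norm_le_const
        (C := ‖X‖ * hΨ.exists_norm_le.choose) ?_).trans (by simp)
      filter_upwards [hK] with θ hθ
      exact (norm_mul_le _ _).trans (mul_le_mul (X.norm_coe_le_norm θ) hθ (norm_nonneg _)
        (norm_nonneg _))

lemma densityFunctional_apply (hΨ : IsSpectralDensity Ψ)
    (X : C(CircleAngle, Matrix (Fin m) (Fin m) ℂ)) :
    densityFunctional hΨ X = rtr m (∫ θ, X θ * Ψ θ ∂circleMeasure) := rfl

/-- Coercivity of `Ψ` bounds the functional below by a multiple of the integrated trace. -/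
lemma IsSpectralDensity.exists_le_densityFunctional (hΨ : IsSpectralDensity Ψ) :
    ∃ c : ℝ, 0 < c ∧ ∀ X : C(CircleAngle, Matrix (Fin m) (Fin m) ℂ), (∀ θ, (X θ).PosSemidef) →
      c * ∫ θ, rtr m (X θ) ∂circleMeasure ≤ densityFunctional hΨ X := by
  obtain ⟨c, hc, hc'⟩ := hΨ.coercive
  refine ⟨c, hc, fun X hX => ?_⟩
  rw [densityFunctional_apply, ← (rtr m).integral_comp_comm (hΨ.integrable_mul X),
    ← integral_const_mul]
  refine integral_mono_ae ((integrable_of_continuous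
    ((rtr m).continuous.comp X.continuous)).const_mul c)
    ((rtr m).integrable_comp (hΨ.integrable_mul X)) ?_
  filter_upwards [hc'] with θ hθ
  have := rtr_mul_nonneg (hX θ) hθ
  rw [mul_sub, map_sub, mul_smul_comm, mul_one, map_smul, smul_eq_mul] at this
  linarith

end Density

/-! ### The dual functional and its domain. -/

section Dual

variable {n m : ℕ} {A : Matrix (Fin n) (Fin n) ℂ} {B : Matrix (Fin n) (Fin m) ℂ}
  {Ψ : CircleAngle → Matrix (Fin m) (Fin m) ℂ}

lemma isUnit_of_mem_LGamma (hA : IsStable A) {Λ : Matrix (Fin n) (Fin n) ℂ}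
    (hΛ : Λ ∈ LGamma A B) : IsUnit (1 + compression hA B Λ) :=
  isUnit_of_posDef hΛ.2.1

lemma dualFunctional_eq (hA : IsStable A) (hΨ : IsSpectralDensity Ψ)
    {S Λ : Matrix (Fin n) (Fin n) ℂ} (hΛ : Λ ∈ LGamma A B) :
    dualFunctional A B Ψ S Λ =
      densityFunctional hΨ (Ring.inverse (1 + compression hA B Λ)) + rtr n (Λ * S) := by
  rw [dualFunctional, Complex.add_re, densityFunctional_apply, rtr_apply, rtr_apply]
  simp only [inverse_apply (isUnit_of_mem_LGamma hA hΛ), one_add_compression_apply]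

lemma continuousAt_inverse_Q (hA : IsStable A) {Λ : Matrix (Fin n) (Fin n) ℂ}
    (hΛ : Λ ∈ LGamma A B) :
    ContinuousAt (fun L => Ring.inverse (1 + compression hA B L)) Λ :=
  ContinuousAt.comp (f := fun L => 1 + compression hA B L)
    (continuousAt_inverse (isUnit_of_mem_LGamma hA hΛ))
    (continuous_const.add (compression hA B).continuous).continuousAt

lemma continuousOn_dualFunctional (hA : IsStable A) (hΨ : IsSpectralDensity Ψ)
    (S : Matrix (Fin n) (Fin n) ℂ) : ContinuousOn (dualFunctional A B Ψ S) (LGamma A B) := by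
  have h : ContinuousOn (fun Λ => densityFunctional hΨ (Ring.inverse (1 + compression hA B Λ)) +
      rtr n (Λ * S)) (LGamma A B) := by
    intro Λ hΛ
    refine ContinuousAt.continuousWithinAt (ContinuousAt.add ?_ ?_)
    · exact (densityFunctional hΨ).continuous.continuousAt.comp (continuousAt_inverse_Q hA hΛ)
    · exact ((rtr n).continuous.comp (continuous_id.mul continuous_const)).continuousAt
  exact h.congr fun Λ hΛ => dualFunctional_eq hA hΨ hΛ

/-- `𝓛_Γ^H` is open relative to the range of `Γ`. -/
lemma exists_closedBall_subset_LGamma (hA : IsStable A) {Λ : Matrix (Fin n) (Fin n) ℂ}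
    (hΛ : Λ ∈ LGamma A B) :
    ∃ r > 0, ∀ L ∈ gammaRange hA B, ‖L - Λ‖ ≤ r → L ∈ LGamma A B := by
  set X := Ring.inverse (1 + compression hA B Λ) with hX
  set M : ℝ := ‖X‖ + 1 with hM
  have hM0 : 0 < M := by positivity
  have hlow : ∀ θ, ((1 + compression hA B Λ) θ - M⁻¹ • 1).PosSemidef := fun θ => by
    refine posSemidef_sub_inv_smul_one (hΛ.2.1 θ) hM0 ?_
    have h1 := X.norm_coe_le_norm θ
    rw [hX, inverse_apply (isUnit_of_mem_LGamma hA hΛ)] at h1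
    exact h1.trans (by linarith)
  set T := ‖compression hA B‖ + 1 with hT
  have hT0 : 0 < T := by positivity
  -- With this radius the perturbation of Q has norm at most (2M)⁻¹, half of the lower bound M⁻¹ for
  -- Q at Λ.
  refine ⟨(2 * M * T)⁻¹, by positivity, fun L hL hr => mem_LGamma_iff.2 ⟨hL, fun θ => ?_⟩⟩
  have hD : (L - Λ).IsHermitian :=
    (isHermitian_of_mem_rangeGamma ((mem_gammaRange hA).1 hL)).sub hΛ.1
  have hDc := isHermitian_compression hA B hD θ
  have hbd : ‖compression hA B (L - Λ) θ‖ ≤ (2 * M)⁻¹ := by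
    calc ‖compression hA B (L - Λ) θ‖ ≤ ‖compression hA B (L - Λ)‖ :=
          ContinuousMap.norm_coe_le_norm _ θ
      _ ≤ ‖compression hA B‖ * ‖L - Λ‖ := (compression hA B).le_opNorm _
      _ ≤ T * (2 * M * T)⁻¹ := by gcongr; linarith
      _ = (2 * M)⁻¹ := by field_simp
  have h1 := posSemidef_norm_smul_one_sub hDc.neg
  rw [norm_neg] at h1
  have h2 : (((2 * M)⁻¹ - ‖compression hA B (L - Λ) θ‖) •
      (1 : Matrix (Fin m) (Fin m) ℂ)).PosSemidef := PosSemidef.one.smul (by linarith)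
  refine posDef_of_sub_smul_one (ε := (2 * M)⁻¹) (by positivity) ?_
  have h3 := ((hlow θ).add h1).add h2
  convert h3 using 1
  have h4 : compression hA B L θ = compression hA B Λ θ + compression hA B (L - Λ) θ := by
    rw [map_sub, ContinuousMap.sub_apply]
    abel
  have h5 : M⁻¹ = (2 * M)⁻¹ + (2 * M)⁻¹ := by field_simp; norm_num
  rw [ContinuousMap.add_apply, h4, ContinuousMap.add_apply, h5, sub_smul, add_smul]
  abel

lemma zero_mem_LGamma (hA : IsStable A) : (0 : Matrix (Fin n) (Fin n) ℂ) ∈ LGamma A B :=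
  (mem_LGamma_iff (hA := hA)).2 ⟨zero_mem _, fun θ => by simpa using PosDef.one⟩

end Dual

/-! ### Compact sublevel sets and existence of a minimum point. -/

section Coercivity

variable {n m : ℕ} {A : Matrix (Fin n) (Fin n) ℂ} {B : Matrix (Fin n) (Fin m) ℂ}
  {Ψ : CircleAngle → Matrix (Fin m) (Fin m) ℂ}

/-- The pointwise inverse is again a continuous function on a compact space, and a uniform bound for
it is a uniform lower bound for f. -/
lemma exists_smul_one_le {f : C(CircleAngle, Matrix (Fin m) (Fin m) ℂ)} (hf : ∀ θ, (f θ).PosDef) :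
    ∃ δ : ℝ, 0 < δ ∧ ∀ θ, (f θ - δ • (1 : Matrix (Fin m) (Fin m) ℂ)).PosSemidef := by
  set X := Ring.inverse f with hX
  refine ⟨(‖X‖ + 1)⁻¹, by positivity, fun θ => ?_⟩
  refine posSemidef_sub_inv_smul_one (hf θ) (by positivity) ?_
  have h1 := X.norm_coe_le_norm θ
  rw [hX, inverse_apply (isUnit_of_posDef hf)] at h1
  exact h1.trans (by linarith)

lemma exists_submoduleMap_rightInverse {E F : Type*} [AddCommGroup E] [Module ℝ E]
    [AddCommGroup F] [Module ℝ F] (f : E →ₗ[ℝ] F) (p : Submodule ℝ E) :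
    ∃ g : p.map f →ₗ[ℝ] p, f.submoduleMap p ∘ₗ g = LinearMap.id :=
  LinearMap.exists_rightInverse_of_surjective _
    (LinearMap.range_eq_top.2 (LinearMap.submoduleMap_surjective f p))

/-- A linear section of Γ is bounded because the range is finite-dimensional; it provides preimages
of Λ of size O(‖Λ‖). -/
lemma exists_gamma_rightInverse (hA : IsStable A) (B : Matrix (Fin n) (Fin m) ℂ) :
    ∃ g : gammaRange hA B →L[ℝ] C(CircleAngle, Matrix (Fin m) (Fin m) ℂ),
      ∀ Λ, gammaOp A B (g Λ) = (Λ : Matrix (Fin n) (Fin n) ℂ) := by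
  obtain ⟨g, hg⟩ := exists_submoduleMap_rightInverse (gammaLinearMap hA B) (hermitianMaps m)
  refine ⟨LinearMap.toContinuousLinearMap ((hermitianMaps m).subtype ∘ₗ g), fun Λ => ?_⟩
  exact congrArg Subtype.val (LinearMap.congr_fun hg Λ)

lemma integrable_rtr (X : C(CircleAngle, Matrix (Fin m) (Fin m) ℂ)) :
    Integrable (fun θ => rtr m (X θ)) circleMeasure :=
  integrable_of_continuous ((rtr m).continuous.comp X.continuous)

/-- On `𝓛_Γ^H`, the functional `Λ ↦ tr (Λ S)` is bounded below, and its sublevel sets are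
bounded. -/
lemma exists_bounds_rtr_mul (hA : IsStable A) (hB : B.rank = m) {S : Matrix (Fin n) (Fin n) ℂ}
    (hS : S ∈ PGamma A B) :
    ∃ c₀ : ℝ, (∀ Λ ∈ LGamma A B, -c₀ ≤ rtr n (Λ * S)) ∧
      ∀ b : ℝ, ∃ R : ℝ, ∀ Λ ∈ LGamma A B, rtr n (Λ * S) ≤ b → ‖Λ‖ ≤ R := by
  obtain ⟨Φ', hΦc, hΦp, hΦS⟩ := exists_posDef_preimage hA hB hS
  obtain ⟨Φ, rfl⟩ : ∃ Φ : C(CircleAngle, Matrix (Fin m) (Fin m) ℂ), ⇑Φ = Φ' := ⟨⟨Φ', hΦc⟩, rfl⟩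
  obtain ⟨δ, hδ, hΦδ⟩ := exists_smul_one_le hΦp
  obtain ⟨g, hg⟩ := exists_gamma_rightInverse hA B
  set c₀ : ℝ := ∫ θ, rtr m (Φ θ) ∂circleMeasure with hc₀
  have hkey : ∀ Λ, rtr n (Λ * S) =
      ∫ θ, rtr m (((1 + compression hA B Λ) * Φ) θ) ∂circleMeasure - c₀ := by
    intro Λ
    rw [← hΦS, rtr_mul_gammaOp hA B Λ Φ.continuous, hc₀,
      ← integral_sub (integrable_rtr _) (integrable_rtr _)]
    refine integral_congr_ae (Filter.Eventually.of_forall fun θ => ?_)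
    simp only [ContinuousMap.mul_apply, ContinuousMap.add_apply, add_mul, one_mul, map_add]
    ring
  refine ⟨c₀, fun Λ hΛ => ?_, fun b => ?_⟩
  · rw [hkey]
    have : 0 ≤ ∫ θ, rtr m (((1 + compression hA B Λ) * Φ) θ) ∂circleMeasure :=
      integral_nonneg fun θ => rtr_mul_nonneg (hΛ.2.1 θ).posSemidef (hΦp θ).posSemidef
    linarith
  · refine ⟨‖rtr m‖ * ‖g‖ * ((b + c₀) / δ + ‖(1 : Matrix (Fin m) (Fin m) ℂ)‖), fun Λ hΛ hb => ?_⟩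
    have hV : Λ ∈ gammaRange hA B := (mem_gammaRange hA).2 hΛ.2.2
    set X := 1 + compression hA B Λ with hX
    have hXp : ∀ θ, (X θ).PosSemidef := fun θ => (hΛ.2.1 θ).posSemidef
    have hI : ∫ θ, rtr m (X θ) ∂circleMeasure ≤ (b + c₀) / δ := by
      rw [le_div_iff₀ hδ, mul_comm, ← integral_const_mul]
      have : ∫ θ, δ * rtr m (X θ) ∂circleMeasure ≤ ∫ θ, rtr m ((X * Φ) θ) ∂circleMeasure := by
        refine integral_mono ((integrable_rtr X).const_mul δ) (integrable_rtr _) fun θ => ?_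
        have := rtr_mul_nonneg (hXp θ) (hΦδ θ)
        rw [mul_sub, map_sub, mul_smul_comm, mul_one, map_smul, smul_eq_mul] at this
        simp only [ContinuousMap.mul_apply]
        linarith
      linarith [hkey Λ]
    -- ‖Λ‖² ≤ tr Λ² = ∫ tr(G*ΛG g(Λ)), where ‖g(Λ)‖ ≤ ‖g‖‖Λ‖ and ‖G*ΛG‖ = ‖Q - I‖ ≤ tr Q + ‖I‖. One
    -- factor ‖Λ‖ then cancels.
    have h1 : ‖Λ‖ * ‖Λ‖ ≤ ‖rtr m‖ * ‖g‖ * ‖Λ‖ *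
        ((b + c₀) / δ + ‖(1 : Matrix (Fin m) (Fin m) ℂ)‖) := by
      refine (sq_norm_le_rtr Λ).trans ?_
      rw [hΛ.1.eq]
      have hgn : ‖g ⟨Λ, hV⟩‖ ≤ ‖g‖ * ‖Λ‖ := g.le_opNorm _
      nth_rewrite 2 [show Λ = gammaOp A B (g ⟨Λ, hV⟩) from (hg ⟨Λ, hV⟩).symm]
      rw [rtr_mul_gammaOp hA B Λ (g ⟨Λ, hV⟩).continuous]
      calc ∫ θ, rtr m (compression hA B Λ θ * g ⟨Λ, hV⟩ θ) ∂circleMeasure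
          ≤ ∫ θ, ‖rtr m‖ * ‖g‖ * ‖Λ‖ * (rtr m (X θ) + ‖(1 : Matrix (Fin m) (Fin m) ℂ)‖)
              ∂circleMeasure := by
            refine integral_mono (integrable_rtr (compression hA B Λ * g ⟨Λ, hV⟩))
              (((integrable_rtr X).add (integrable_const _)).const_mul _) fun θ => ?_
            have h2 : compression hA B Λ θ = X θ - 1 := by
              rw [hX, ContinuousMap.add_apply, ContinuousMap.one_apply, add_sub_cancel_left]
            have h3 : ‖compression hA B Λ θ‖ ≤ rtr m (X θ) + ‖(1 : Matrix (Fin m) (Fin m) ℂ)‖ := by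
              rw [h2]
              exact (norm_sub_le _ _).trans (add_le_add_left (norm_le_rtr (hXp θ)) _)
            have h4 : ‖g ⟨Λ, hV⟩ θ‖ ≤ ‖g‖ * ‖Λ‖ := (ContinuousMap.norm_coe_le_norm _ θ).trans hgn
            calc rtr m (compression hA B Λ θ * g ⟨Λ, hV⟩ θ)
                ≤ ‖rtr m‖ * ‖compression hA B Λ θ * g ⟨Λ, hV⟩ θ‖ :=
                  (Real.le_norm_self _).trans ((rtr m).le_opNorm _)
              _ ≤ ‖rtr m‖ * ((rtr m (X θ) + ‖(1 : Matrix (Fin m) (Fin m) ℂ)‖) * (‖g‖ * ‖Λ‖)) := by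
                  refine mul_le_mul_of_nonneg_left ((norm_mul_le _ _).trans ?_) (norm_nonneg _)
                  exact mul_le_mul h3 h4 (norm_nonneg _) ((norm_nonneg _).trans h3)
              _ = _ := by ring
        _ = ‖rtr m‖ * ‖g‖ * ‖Λ‖ * (∫ θ, rtr m (X θ) ∂circleMeasure +
              ‖(1 : Matrix (Fin m) (Fin m) ℂ)‖) := by
            rw [integral_const_mul, integral_add (integrable_rtr X) (integrable_const _)]
            simp
        _ ≤ _ := by gcongr
    rcases (norm_nonneg Λ).eq_or_lt with h0 | h0
    · have h5 : 0 ≤ (b + c₀) / δ := le_trans (integral_nonneg fun θ => rtr_nonneg (hXp θ)) hI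
      rw [← h0]
      positivity
    · refine le_of_mul_le_mul_right (h1.trans (le_of_eq (by ring))) h0

lemma norm_toCircle_sub_le (x y : ℝ) :
    ‖(AddCircle.toCircle (x : CircleAngle) : ℂ) - (AddCircle.toCircle (y : CircleAngle) : ℂ)‖
      ≤ |x - y| := by
  have h : ∀ x : ℝ, (AddCircle.toCircle (x : CircleAngle) : ℂ) = Complex.exp (Complex.I * x) := by
    intro x
    rw [AddCircle.toCircle_apply_mk, Circle.coe_exp, div_self Real.two_pi_pos.ne', one_mul, mul_comm]
  have h2 : Complex.exp (Complex.I * x) - Complex.exp (Complex.I * y) =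
      Complex.exp (Complex.I * y) * (Complex.exp (Complex.I * (x - y : ℝ)) - 1) := by
    rw [mul_sub, mul_one, ← Complex.exp_add]
    congr 2
    push_cast
    ring
  rw [h, h, h2, norm_mul, mul_comm Complex.I, Complex.norm_exp_ofReal_mul_I, one_mul]
  exact Real.norm_exp_I_mul_ofReal_sub_one_le

/-- By the resolvent identity, G(x) - G(y) = (z_y - z_x)(z_x I - A)⁻¹G(y), and the resolvent is
bounded on the circle. -/
lemma IsStable.exists_lipschitz_transfer (hA : IsStable A) (B : Matrix (Fin n) (Fin m) ℂ) :
    ∃ K : ℝ, 0 < K ∧ (∀ θ, ‖transfer A B θ‖ ≤ K) ∧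
      ∀ x y : ℝ, ‖transfer A B (x : CircleAngle) - transfer A B (y : CircleAngle)‖ ≤ K * |x - y| := by
  obtain ⟨M, hM0, hM⟩ := hA.exists_norm_resolvent_le
  set K := M * (‖B‖ + 1) with hK
  have hGK : ∀ θ, ‖transfer A B θ‖ ≤ K := fun θ => by
    refine (l2_opNorm_mul _ _).trans (mul_le_mul (hM θ) ?_ (norm_nonneg _) hM0.le)
    linarith
  refine ⟨max K (M * K), by positivity, fun θ => (hGK θ).trans (le_max_left _ _), fun x y => ?_⟩
  set zx : ℂ := (AddCircle.toCircle (x : CircleAngle) : ℂ) with hzx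
  set zy : ℂ := (AddCircle.toCircle (y : CircleAngle) : ℂ) with hzy
  have hu : (zx • (1 : Matrix (Fin n) (Fin n) ℂ) - A)⁻¹ *
      (zx • (1 : Matrix (Fin n) (Fin n) ℂ) - A) = 1 :=
    nonsing_inv_mul _ ((Matrix.isUnit_iff_isUnit_det _).1 (hA.isUnit_circle (x : CircleAngle)))
  have h1 : transfer A B (x : CircleAngle) - transfer A B (y : CircleAngle) =
      (zy - zx) • ((zx • (1 : Matrix (Fin n) (Fin n) ℂ) - A)⁻¹ * transfer A B (y : CircleAngle)) := by
    have e1 : (zx • (1 : Matrix (Fin n) (Fin n) ℂ) - A) * transfer A B (y : CircleAngle) =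
        B - (zy - zx) • transfer A B (y : CircleAngle) := by
      have := hA.mul_transfer B (y : CircleAngle)
      rw [Matrix.sub_mul, this, Matrix.smul_mul, Matrix.one_mul, sub_smul]
      abel
    have e2 : transfer A B (y : CircleAngle) = transfer A B (x : CircleAngle) -
        (zy - zx) • ((zx • (1 : Matrix (Fin n) (Fin n) ℂ) - A)⁻¹ *
          transfer A B (y : CircleAngle)) := by
      calc transfer A B (y : CircleAngle) = (zx • (1 : Matrix (Fin n) (Fin n) ℂ) - A)⁻¹ *
            ((zx • (1 : Matrix (Fin n) (Fin n) ℂ) - A) * transfer A B (y : CircleAngle)) := by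
            rw [← Matrix.mul_assoc, hu, Matrix.one_mul]
        _ = _ := by
            rw [e1, Matrix.mul_sub, Matrix.mul_smul]
            rfl
    rw [sub_eq_iff_eq_add]
    conv_rhs => rw [add_comm]
    exact (eq_sub_iff_add_eq.1 e2).symm
  rw [h1, norm_smul, mul_comm]
  refine mul_le_mul (((l2_opNorm_mul _ _).trans (mul_le_mul (hM _) (hGK _) (norm_nonneg _)
    hM0.le)).trans (le_max_right _ _)) ?_ (norm_nonneg _) (by positivity)
  rw [norm_sub_rev]
  exact norm_toCircle_sub_le x y

lemma exists_lipschitz_compression (hA : IsStable A) (B : Matrix (Fin n) (Fin m) ℂ) (R : ℝ) :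
    ∃ L : ℝ, 0 < L ∧ ∀ Λ : Matrix (Fin n) (Fin n) ℂ, ‖Λ‖ ≤ R → ∀ x y : ℝ,
      ‖compression hA B Λ (x : CircleAngle) - compression hA B Λ (y : CircleAngle)‖
        ≤ L * |x - y| := by
  obtain ⟨K, hK0, hK, hKL⟩ := hA.exists_lipschitz_transfer B
  refine ⟨2 * K * (|R| + 1) * K, by positivity, fun Λ hΛ x y => ?_⟩
  have hR : ‖Λ‖ ≤ |R| + 1 := hΛ.trans ((le_abs_self R).trans (by linarith))
  rw [compression_apply, compression_apply]
  set X := transfer A B (x : CircleAngle)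
  set Y := transfer A B (y : CircleAngle)
  have h1 : Xᴴ * Λ * X - Yᴴ * Λ * Y = (X - Y)ᴴ * Λ * X + Yᴴ * Λ * (X - Y) := by
    rw [conjTranspose_sub]
    simp only [Matrix.sub_mul, Matrix.mul_sub]
    abel
  have h2 : ∀ P T : Matrix (Fin n) (Fin m) ℂ, ‖Pᴴ * Λ * T‖ ≤ ‖P‖ * ‖Λ‖ * ‖T‖ := by
    intro P T
    refine (l2_opNorm_mul _ _).trans (mul_le_mul_of_nonneg_right ?_ (norm_nonneg _))
    rw [← l2_opNorm_conjTranspose P]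
    exact l2_opNorm_mul _ _
  rw [h1]
  calc _ ≤ ‖X - Y‖ * ‖Λ‖ * ‖X‖ + ‖Y‖ * ‖Λ‖ * ‖X - Y‖ := (norm_add_le _ _).trans
        (add_le_add (h2 _ _) (h2 _ _))
    _ ≤ (K * |x - y|) * (|R| + 1) * K + K * (|R| + 1) * (K * |x - y|) := by
        have := hKL x y
        have hx := hK (x : CircleAngle)
        have hy := hK (y : CircleAngle)
        gcongr
    _ = _ := by ring

lemma rtr_vecMulVec_pos {v : Fin m → ℂ} (hv : v ≠ 0) : 0 < rtr m (vecMulVec v (star v)) := by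
  have h := rtr_vecMulVec (1 : Matrix (Fin m) (Fin m) ℂ) v
  rw [one_mul] at h
  rw [h]
  exact (Complex.lt_def.1 (PosDef.one.dotProduct_mulVec_pos hv)).1

/-- A lower bound that holds for the unit vectors holds for all vectors. -/
lemma posSemidef_sub_smul_one_of_unit {X : Matrix (Fin m) (Fin m) ℂ} (hX : X.IsHermitian) {ε : ℝ}
    (h : ∀ v : Fin m → ℂ, rtr m (vecMulVec v (star v)) = 1 →
      ε ≤ rtr m (X * vecMulVec v (star v))) :
    (X - ε • (1 : Matrix (Fin m) (Fin m) ℂ)).PosSemidef := by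
  have hh : (X - ε • (1 : Matrix (Fin m) (Fin m) ℂ)).IsHermitian := by
    refine hX.sub ?_
    unfold Matrix.IsHermitian
    rw [conjTranspose_smul, conjTranspose_one, star_trivial]
  refine (posSemidef_iff_rtr hh).2 fun v => ?_
  rcases eq_or_ne v 0 with rfl | hv
  · simp
  have ht := rtr_vecMulVec_pos hv
  set t := rtr m (vecMulVec v (star v)) with ht'
  have hs : vecMulVec ((√t)⁻¹ • v) (star ((√t)⁻¹ • v)) = t⁻¹ • vecMulVec v (star v) := by
    rw [star_smul, star_trivial, smul_vecMulVec, vecMulVec_smul, smul_smul, ← mul_inv,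
      Real.mul_self_sqrt ht.le]
  have h1 := h ((√t)⁻¹ • v) (by rw [hs, map_smul, smul_eq_mul, ← ht', inv_mul_cancel₀ ht.ne'])
  rw [hs, mul_smul_comm, map_smul, smul_eq_mul, le_inv_mul_iff₀ ht] at h1
  rw [sub_mul, map_sub, smul_mul_assoc, one_mul, map_smul, smul_eq_mul, ← ht']
  linarith

/-- The logarithm diverges as e → 0; this is what excludes near-singular Q. -/
lemma integral_inv_affine {e L : ℝ} (he : 0 < e) (hL : 0 < L) (t : ℝ) {T : ℝ} (hT : 0 < T) :
    ∫ x in t..(t + T), (e + L * (x - t))⁻¹ = L⁻¹ * Real.log ((e + L * T) / e) := by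
  have hpos : ∀ x ∈ Set.uIcc t (t + T), 0 < e + L * (x - t) := by
    intro x hx
    rw [Set.uIcc_of_le (by linarith)] at hx
    have := mul_nonneg hL.le (sub_nonneg.2 hx.1)
    linarith
  have hd : ∀ x ∈ Set.uIcc t (t + T),
      HasDerivAt (fun x => L⁻¹ * Real.log (e + L * (x - t))) ((e + L * (x - t))⁻¹) x := by
    intro x hx
    have h1 : HasDerivAt (fun x => e + L * (x - t)) (L * 1) x :=
      (((hasDerivAt_id x).sub_const t).const_mul L).const_add e
    have h2 := (h1.log (hpos x hx).ne').const_mul L⁻¹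
    refine h2.congr_deriv ?_
    rw [mul_one, div_eq_mul_inv, ← mul_assoc, inv_mul_cancel₀ hL.ne', one_mul]
  rw [intervalIntegral.integral_eq_sub_of_hasDerivAt hd, ← mul_sub, ← Real.log_div]
  · simp
  · exact (hpos _ Set.right_mem_uIcc).ne'
  · simpa using he.ne'
  · refine ContinuousOn.intervalIntegrable ?_
    exact ContinuousOn.inv₀ (by fun_prop) fun x hx => (hpos x hx).ne'

/-- A bound for `Λ` and for `∫ tr (I + G* Λ G)⁻¹` keeps `I + G* Λ G` away from the singular
matrices. -/
lemma exists_lower_bound_Q (hA : IsStable A) (B : Matrix (Fin n) (Fin m) ℂ) (R R' : ℝ) :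
    ∃ ε : ℝ, 0 < ε ∧ ∀ Λ ∈ LGamma A B, ‖Λ‖ ≤ R →
      ∫ θ, rtr m (Ring.inverse (1 + compression hA B Λ) θ) ∂circleMeasure ≤ R' →
      ∀ θ, ((1 + compression hA B Λ) θ - ε • (1 : Matrix (Fin m) (Fin m) ℂ)).PosSemidef := by
  obtain ⟨L, hL0, hL⟩ := exists_lipschitz_compression hA B R
  have hπ := Real.two_pi_pos
  -- This ε comes from solving log((e + 2πL)/e) ≤ 2πLR' for e, after discarding the summand e in the
  -- numerator.
  refine ⟨L * (2 * Real.pi) * Real.exp (-(L * (2 * Real.pi) * R')), by positivity,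
    fun Λ hΛ hR hI θ => ?_⟩
  set X := 1 + compression hA B Λ with hX
  have hXp : ∀ θ, (X θ).PosDef := hΛ.2.1
  refine posSemidef_sub_smul_one_of_unit (hXp θ).1 fun v hv => ?_
  obtain ⟨t, rfl⟩ := QuotientAddGroup.mk_surjective θ
  set e := rtr m (X (t : CircleAngle) * vecMulVec v (star v)) with he
  have hv0 : v ≠ 0 := by
    rintro rfl
    simp at hv
  have he0 : 0 < e := by
    rw [he, rtr_vecMulVec]
    exact (Complex.lt_def.1 ((hXp _).dotProduct_mulVec_pos hv0)).1
  -- To the right of t the quadratic form of Q at v grows at rate at most L from its value e, so tr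
  -- Q⁻¹ is at least the reciprocal of an affine function, integrated below over one period.
  have hpt : ∀ x : ℝ, t ≤ x →
      (e + L * (x - t))⁻¹ ≤ rtr m (Ring.inverse X (x : CircleAngle)) := by
    intro x hx
    rw [inverse_apply (isUnit_of_posDef hXp)]
    have h0 : 0 ≤ L * (x - t) := mul_nonneg hL0.le (sub_nonneg.2 hx)
    refine inv_le_rtr_inv (hXp _) hv (by linarith) ?_
    have hW := posSemidef_vecMulVec_self_star v
    have h1 := abs_rtr_mul_le ((hXp (x : CircleAngle)).1.sub (hXp (t : CircleAngle)).1) hW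
    have h2 : X (x : CircleAngle) - X (t : CircleAngle) =
        compression hA B Λ (x : CircleAngle) - compression hA B Λ (t : CircleAngle) := by
      simp [hX]
    have h3 := hL Λ hR x t
    rw [abs_of_nonneg (sub_nonneg.2 hx), ← h2] at h3
    rw [hv, mul_one, sub_mul, map_sub] at h1
    linarith [le_abs_self (rtr m (X (x : CircleAngle) * vecMulVec v (star v)) - e)]
  have hint : ∫ θ, rtr m (Ring.inverse X θ) ∂circleMeasure =
      (2 * Real.pi)⁻¹ * ∫ x in t..(t + 2 * Real.pi), rtr m (Ring.inverse X (x : CircleAngle)) := by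
    have h := AddCircle.intervalIntegral_preimage (2 * Real.pi) t
      fun θ => rtr m (Ring.inverse X θ)
    rw [h, AddCircle.integral_haarAddCircle, smul_eq_mul]
  have hlog : L⁻¹ * Real.log ((e + L * (2 * Real.pi)) / e) ≤ 2 * Real.pi * R' := by
    rw [← integral_inv_affine he0 hL0 t hπ]
    rw [hint, inv_mul_le_iff₀ hπ] at hI
    refine le_trans ?_ hI
    refine intervalIntegral.integral_mono_on (by linarith) ?_ ?_ fun x hx => hpt x hx.1
    · refine ContinuousOn.intervalIntegrable (ContinuousOn.inv₀ (by fun_prop) fun x hx => ?_)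
      rw [Set.uIcc_of_le (by linarith)] at hx
      have := mul_nonneg hL0.le (sub_nonneg.2 hx.1)
      linarith
    · refine Continuous.intervalIntegrable ?_ _ _
      exact (rtr m).continuous.comp ((Ring.inverse X).continuous.comp
        (AddCircle.continuous_mk' _))
  rw [inv_mul_le_iff₀ hL0, Real.log_le_iff_le_exp (by positivity), div_le_iff₀ he0] at hlog
  rw [Real.exp_neg, ← div_eq_mul_inv, div_le_iff₀ (Real.exp_pos _)]
  calc L * (2 * Real.pi) ≤ e + L * (2 * Real.pi) := by linarith
    _ ≤ _ := hlog
    _ = _ := by rw [mul_comm]; congr 2; ring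

/-- The dual functional has a minimum point. -/
lemma exists_isDualMinimizer (hA : IsStable A) (hB : B.rank = m) (hΨ : IsSpectralDensity Ψ)
    {S : Matrix (Fin n) (Fin n) ℂ} (hS : S ∈ PGamma A B) : ∃ Λ, IsDualMinimizer A B Ψ S Λ := by
  obtain ⟨c₀, hlow, hbdd⟩ := exists_bounds_rtr_mul hA hB hS
  obtain ⟨c, hc, hcF⟩ := hΨ.exists_le_densityFunctional
  set J := dualFunctional A B Ψ S with hJ
  -- If J(Λ) ≤ J(0), then tr(ΛS) ≤ J(0) since the integral term is nonnegative, and c ∫ tr Q⁻¹ ≤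
  -- J(0) + c₀ since tr(ΛS) ≥ -c₀.
  obtain ⟨R, hR⟩ := hbdd (J 0)
  obtain ⟨ε, hε, hεQ⟩ := exists_lower_bound_Q hA B R ((J 0 + c₀) / c)
  set K : Set (Matrix (Fin n) (Fin n) ℂ) := {Λ | Λ ∈ gammaRange hA B ∧ ‖Λ‖ ≤ R ∧
    ∀ θ (v : Fin m → ℂ), 0 ≤ rtr m (((1 + compression hA B Λ) θ -
      ε • (1 : Matrix (Fin m) (Fin m) ℂ)) * vecMulVec v (star v))} with hK
  have hsub : ∀ Λ ∈ LGamma A B, J Λ ≤ J 0 → Λ ∈ K := by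
    intro Λ hΛ hle
    have hXp : ∀ θ, (Ring.inverse (1 + compression hA B Λ) θ).PosSemidef := fun θ => by
      rw [inverse_apply (isUnit_of_mem_LGamma hA hΛ)]
      exact (hΛ.2.1 θ).inv.posSemidef
    have h1 := hcF _ hXp
    have h2 : 0 ≤ ∫ θ, rtr m (Ring.inverse (1 + compression hA B Λ) θ) ∂circleMeasure :=
      integral_nonneg fun θ => rtr_nonneg (hXp θ)
    have h3 : J Λ = _ := dualFunctional_eq hA hΨ hΛ
    have h4 := mul_nonneg hc.le h2
    have h5 := hlow Λ hΛ
    have hΛR : ‖Λ‖ ≤ R := hR Λ hΛ (by linarith)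
    refine ⟨(mem_gammaRange hA).2 hΛ.2.2, hΛR, fun θ v => ?_⟩
    refine rtr_mul_nonneg (hεQ Λ hΛ hΛR ?_ θ) (posSemidef_vecMulVec_self_star v)
    rw [le_div_iff₀ hc]
    linarith
  have hKL : K ⊆ LGamma A B := by
    rintro Λ ⟨hV, -, hQ⟩
    refine (mem_LGamma_iff (hA := hA)).2 ⟨hV, fun θ => posDef_of_sub_smul_one hε ?_⟩
    have hh : ((1 + compression hA B Λ) θ - ε • (1 : Matrix (Fin m) (Fin m) ℂ)).IsHermitian := by
      refine IsHermitian.sub (isHermitian_one.add (isHermitian_compression hA B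
        (isHermitian_of_mem_rangeGamma ((mem_gammaRange hA).1 hV)) θ)) ?_
      unfold Matrix.IsHermitian
      rw [conjTranspose_smul, conjTranspose_one, star_trivial]
    exact (posSemidef_iff_rtr hh).2 (hQ θ)
  have hKc : IsCompact K := by
    have : ProperSpace (Matrix (Fin n) (Fin n) ℂ) := FiniteDimensional.proper ℂ _
    refine Metric.isCompact_of_isClosed_isBounded ?_ ?_
    · have hKeq : K = (gammaRange hA B : Set (Matrix (Fin n) (Fin n) ℂ)) ∩
          ({Λ | ‖Λ‖ ≤ R} ∩ ⋂ (θ : CircleAngle) (v : Fin m → ℂ),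
            {Λ | 0 ≤ rtr m (((1 + compression hA B Λ) θ -
              ε • (1 : Matrix (Fin m) (Fin m) ℂ)) * vecMulVec v (star v))}) := by
        ext Λ
        simp only [hK, Set.mem_inter_iff, Set.mem_iInter, Set.mem_ofPred_eq, SetLike.mem_coe]
      rw [hKeq]
      refine (Submodule.closed_of_finiteDimensional (gammaRange hA B)).inter
        ((isClosed_le continuous_norm continuous_const).inter ?_)
      refine isClosed_iInter fun θ => isClosed_iInter fun v => isClosed_le continuous_const ?_
      refine (rtr m).continuous.comp (Continuous.mul (Continuous.sub ?_ continuous_const)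
        continuous_const)
      exact (continuous_eval_const θ).comp
        (continuous_const.add (compression hA B).continuous)
    · exact (Metric.isBounded_closedBall (x := (0 : Matrix (Fin n) (Fin n) ℂ)) (r := R)).subset
        fun Λ hΛ => mem_closedBall_zero_iff.2 hΛ.2.1
  have h0 := zero_mem_LGamma (B := B) hA
  obtain ⟨Λ, hΛK, hmin⟩ := hKc.exists_isMinOn ⟨0, hsub 0 h0 le_rfl⟩
    ((continuousOn_dualFunctional hA hΨ S).mono hKL)
  refine ⟨Λ, hKL hΛK, fun L hL => ?_⟩
  rcases le_total (J L) (J 0) with h | h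
  · exact hmin (hsub L hL h)
  · exact (hmin (hsub 0 h0 le_rfl)).trans h

end Coercivity

/-! ### Quantitative convexity and uniqueness. -/

section Convexity

variable {n m : ℕ} {A : Matrix (Fin n) (Fin n) ℂ} {B : Matrix (Fin n) (Fin m) ℂ}
  {Ψ : CircleAngle → Matrix (Fin m) (Fin m) ℂ}

/-- Tangent inequality for `f ↦ ∫ tr f⁻¹ Ψ`, with a quadratic remainder. -/
lemma IsSpectralDensity.exists_tangent_le (hΨ : IsSpectralDensity Ψ)
    {f : C(CircleAngle, Matrix (Fin m) (Fin m) ℂ)} (hf : ∀ θ, (f θ).PosDef) :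
    ∃ c : ℝ, 0 < c ∧ ∀ Y ∈ hermitianMaps m,
      densityFunctional hΨ (Y + Y - Y * f * Y) +
        c * ∫ θ, ‖(Ring.inverse f - Y) θ‖ * ‖(Ring.inverse f - Y) θ‖ ∂circleMeasure ≤
      densityFunctional hΨ (Ring.inverse f) := by
  obtain ⟨c, hc, hcF⟩ := hΨ.exists_le_densityFunctional
  obtain ⟨δ, hδ, hfδ⟩ := exists_smul_one_le hf
  refine ⟨c * δ, by positivity, fun Y hY => ?_⟩
  set Z := Ring.inverse f - Y with hZ
  have hZh : ∀ θ, (Z θ).IsHermitian := fun θ => by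
    rw [hZ, ContinuousMap.sub_apply, inverse_apply (isUnit_of_posDef hf)]
    exact (hf θ).inv.1.sub (hY θ)
  have hD : ∀ θ, (Ring.inverse f - (Y + Y - Y * f * Y)) θ = Z θ * f θ * Z θ := by
    intro θ
    simp only [hZ, ContinuousMap.sub_apply, ContinuousMap.add_apply, ContinuousMap.mul_apply,
      inverse_apply (isUnit_of_posDef hf)]
    rw [← inv_sub_eq (hf θ), two_smul]
  have h1 := hcF (Ring.inverse f - (Y + Y - Y * f * Y)) fun θ => by
    rw [hD]
    have := (hf θ).posSemidef.conjTranspose_mul_mul_same (Z θ)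
    rwa [(hZh θ).eq] at this
  have h2 : δ * ∫ θ, ‖Z θ‖ * ‖Z θ‖ ∂circleMeasure ≤
      ∫ θ, rtr m ((Ring.inverse f - (Y + Y - Y * f * Y)) θ) ∂circleMeasure := by
    rw [← integral_const_mul]
    refine integral_mono ((integrable_of_continuous
      (Z.continuous.norm.mul Z.continuous.norm)).const_mul δ) (integrable_rtr _) fun θ => ?_
    simp only
    -- The trace of ZfZ is tr(fZ²) ≥ δ tr Z² ≥ δ‖Z‖².
    rw [hD, rtr_mul_comm, ← Matrix.mul_assoc, rtr_mul_comm]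
    have hp := posSemidef_conjTranspose_mul_self (Z θ)
    have h3 := rtr_mul_nonneg (hfδ θ) hp
    have h4 := sq_norm_le_rtr (Z θ)
    rw [(hZh θ).eq] at h3 h4
    rw [sub_mul, map_sub, smul_mul_assoc, one_mul, map_smul, smul_eq_mul] at h3
    have h5 := mul_le_mul_of_nonneg_left h4 hδ.le
    linarith
  rw [map_sub] at h1
  have h6 := mul_le_mul_of_nonneg_left h2 hc.le
  rw [mul_assoc c δ]
  linarith

lemma one_add_compression_combination (hA : IsStable A) (Λ L : Matrix (Fin n) (Fin n) ℂ)
    {a b : ℝ} (hab : a + b = 1) : 1 + compression hA B (a • Λ + b • L) =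
      a • (1 + compression hA B Λ) + b • (1 + compression hA B L) := by
  ext1 θ
  rw [map_add, map_smul, map_smul]
  simp only [ContinuousMap.add_apply, ContinuousMap.smul_apply, ContinuousMap.one_apply, smul_add]
  rw [add_add_add_comm, ← add_smul, hab, one_smul]

lemma convex_LGamma (hA : IsStable A) : Convex ℝ (LGamma A B) := by
  intro Λ hΛ L hL a b ha hb hab
  rw [mem_LGamma_iff (hA := hA)] at hΛ hL ⊢
  refine ⟨(gammaRange hA B).convex hΛ.1 hL.1 ha hb hab, fun θ => ?_⟩
  rw [one_add_compression_combination hA Λ L hab, ContinuousMap.add_apply,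
    ContinuousMap.smul_apply, ContinuousMap.smul_apply]
  rcases ha.eq_or_lt with rfl | ha
  · rw [zero_add] at hab
    rw [hab, zero_smul, zero_add, one_smul]
    exact hL.2 θ
  · exact ((hΛ.2 θ).smul ha).add_posSemidef ((hL.2 θ).posSemidef.smul hb)

lemma inverse_Q_mem_hermitianMaps (hA : IsStable A) {Λ : Matrix (Fin n) (Fin n) ℂ}
    (hΛ : Λ ∈ LGamma A B) : Ring.inverse (1 + compression hA B Λ) ∈ hermitianMaps m := by
  intro θ
  rw [inverse_apply (isUnit_of_mem_LGamma hA hΛ)]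
  exact (hΛ.2.1 θ).inv.1

/-- Convexity of the dual functional, with a quadratic remainder. -/
lemma exists_dualFunctional_convex (hA : IsStable A) (hΨ : IsSpectralDensity Ψ)
    (S : Matrix (Fin n) (Fin n) ℂ) {Λ : Matrix (Fin n) (Fin n) ℂ} (hΛ : Λ ∈ LGamma A B) :
    ∃ c : ℝ, 0 < c ∧ ∀ L ∈ LGamma A B, ∀ a b : ℝ, 0 ≤ a → 0 ≤ b → a + b = 1 →
      dualFunctional A B Ψ S (a • Λ + b • L) +
        a * (c * ∫ θ, ‖(Ring.inverse (1 + compression hA B Λ) -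
          Ring.inverse (1 + compression hA B (a • Λ + b • L))) θ‖ *
          ‖(Ring.inverse (1 + compression hA B Λ) -
          Ring.inverse (1 + compression hA B (a • Λ + b • L))) θ‖ ∂circleMeasure) ≤
      a * dualFunctional A B Ψ S Λ + b * dualFunctional A B Ψ S L := by
  obtain ⟨c, hc, hcT⟩ := hΨ.exists_tangent_le
    (f := 1 + compression hA B Λ) hΛ.2.1
  refine ⟨c, hc, fun L hL a b ha hb hab => ?_⟩
  have hT := convex_LGamma hA hΛ hL ha hb hab
  obtain ⟨c', hc', hcT'⟩ := hΨ.exists_tangent_le (f := 1 + compression hA B L) hL.2.1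
  have hYh := inverse_Q_mem_hermitianMaps hA hT
  have hYu := isUnit_of_mem_LGamma hA hT
  rw [dualFunctional_eq hA hΨ hΛ, dualFunctional_eq hA hΨ hL, dualFunctional_eq hA hΨ hT]
  have hQT := one_add_compression_combination (B := B) hA Λ L hab
  set Y := Ring.inverse (1 + compression hA B (a • Λ + b • L)) with hY
  have h1 := mul_le_mul_of_nonneg_left (hcT Y hYh) ha
  have h2 := hcT' Y hYh
  have h3 : 0 ≤ c' * ∫ θ, ‖(Ring.inverse (1 + compression hA B L) - Y) θ‖ *
      ‖(Ring.inverse (1 + compression hA B L) - Y) θ‖ ∂circleMeasure :=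
    mul_nonneg hc'.le (integral_nonneg fun θ => mul_self_nonneg _)
  have h4 := mul_le_mul_of_nonneg_left ((le_add_of_nonneg_right h3).trans h2) hb
  -- The map f ↦ 2Y - YfY is affine, and at the convex combination its value is Y itself, so the two
  -- tangent bounds average to the functional at that point.
  have h5 : a • (Y + Y - Y * (1 + compression hA B Λ) * Y) +
      b • (Y + Y - Y * (1 + compression hA B L) * Y) = Y := by
    have e1 : Y * (1 + compression hA B (a • Λ + b • L)) * Y = Y := by
      rw [hY, Ring.inverse_mul_cancel _ hYu, one_mul]
    rw [hQT, mul_add, add_mul, mul_smul_comm, mul_smul_comm, smul_mul_assoc, smul_mul_assoc] at e1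
    rw [smul_sub, smul_sub, sub_add_sub_comm, e1, ← add_smul, hab, one_smul,
      add_sub_cancel_right]
  have h6 := congrArg (densityFunctional hΨ) h5
  rw [map_add, map_smul, map_smul, smul_eq_mul, smul_eq_mul] at h6
  have h7 : rtr n ((a • Λ + b • L) * S) = a * rtr n (Λ * S) + b * rtr n (L * S) := by
    rw [add_mul, map_add, smul_mul_assoc, smul_mul_assoc, map_smul, map_smul, smul_eq_mul,
      smul_eq_mul]
  rw [h7]
  linarith

lemma convexOn_dualFunctional (hA : IsStable A) (hΨ : IsSpectralDensity Ψ)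
    (S : Matrix (Fin n) (Fin n) ℂ) : ConvexOn ℝ (LGamma A B) (dualFunctional A B Ψ S) := by
  refine ⟨convex_LGamma hA, fun Λ hΛ L hL a b ha hb hab => ?_⟩
  obtain ⟨c, hc, h⟩ := exists_dualFunctional_convex hA hΨ S hΛ
  refine le_trans (le_add_of_nonneg_right ?_) (h L hL a b ha hb hab)
  exact mul_nonneg ha (mul_nonneg hc.le (integral_nonneg fun θ => mul_self_nonneg _))

lemma eq_zero_of_integral_norm_mul_norm {Z : C(CircleAngle, Matrix (Fin m) (Fin m) ℂ)}
    (h : ∫ θ, ‖Z θ‖ * ‖Z θ‖ ∂circleMeasure ≤ 0) : Z = 0 := by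
  have hc : Continuous fun θ => ‖Z θ‖ * ‖Z θ‖ := Z.continuous.norm.mul Z.continuous.norm
  have h0 : ∫ θ, ‖Z θ‖ * ‖Z θ‖ ∂circleMeasure = 0 :=
    le_antisymm h (integral_nonneg fun θ => mul_self_nonneg _)
  rw [integral_eq_zero_iff_of_nonneg (fun θ => mul_self_nonneg _) (integrable_of_continuous hc),
    hc.ae_eq_iff_eq _ continuous_zero] at h0
  ext1 θ
  exact norm_eq_zero.1 (mul_self_eq_zero.1 (congrFun h0 θ))

/-- At the midpoint T the quadratic remainder must vanish, so Λ and T give the same Q⁻¹, hence the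
same G*ΛG; injectivity on the range of Γ gives Λ = T. -/
lemma isDualMinimizer_unique (hA : IsStable A) (hΨ : IsSpectralDensity Ψ)
    {S Λ L : Matrix (Fin n) (Fin n) ℂ} (hΛ : IsDualMinimizer A B Ψ S Λ)
    (hL : IsDualMinimizer A B Ψ S L) : Λ = L := by
  obtain ⟨c, hc, h⟩ := exists_dualFunctional_convex hA hΨ S hΛ.1
  have h1 := h L hL.1 (1 / 2) (1 / 2) (by norm_num) (by norm_num) (by norm_num)
  have hT := convex_LGamma hA hΛ.1 hL.1 (a := 1 / 2) (b := 1 / 2) (by norm_num) (by norm_num)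
    (by norm_num)
  set T := (1 / 2 : ℝ) • Λ + (1 / 2 : ℝ) • L with hTdef
  have h2 : dualFunctional A B Ψ S Λ ≤ dualFunctional A B Ψ S T := hΛ.2 hT
  have h3 : dualFunctional A B Ψ S L ≤ dualFunctional A B Ψ S Λ := hL.2 hΛ.1
  have h4 := eq_zero_of_integral_norm_mul_norm
    (Z := Ring.inverse (1 + compression hA B Λ) - Ring.inverse (1 + compression hA B T))
    (by
      refine le_of_mul_le_mul_left ?_ hc
      linarith)
  have h5 : 1 + compression hA B Λ = 1 + compression hA B T := by
    have hu := isUnit_of_mem_LGamma hA hΛ.1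
    have hu' := isUnit_of_mem_LGamma hA hT
    rw [sub_eq_zero] at h4
    calc 1 + compression hA B Λ = (1 + compression hA B Λ) *
          (Ring.inverse (1 + compression hA B T) * (1 + compression hA B T)) := by
          rw [Ring.inverse_mul_cancel _ hu', mul_one]
      _ = 1 + compression hA B T := by rw [← h4, ← mul_assoc, Ring.mul_inverse_cancel _ hu, one_mul]
  have h6 : compression hA B (Λ - T) = 0 := by
    rw [map_sub, sub_eq_zero]
    exact add_left_cancel h5
  have h7 : Λ - T ∈ rangeGamma A B := (mem_gammaRange hA).1
    (sub_mem ((mem_gammaRange hA).2 hΛ.1.2.2) ((mem_gammaRange hA).2 hT.2.2))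
  have h8 := compression_injOn hA h7 h6
  have h9 : Λ - T = (1 / 2 : ℝ) • (Λ - L) := by
    rw [hTdef]
    module
  rw [h9, smul_eq_zero] at h8
  exact sub_eq_zero.1 (h8.resolve_left (by norm_num))

end Convexity

/-! ### Continuous dependence on Σ. -/

section Continuity

variable {n m : ℕ} {A : Matrix (Fin n) (Fin n) ℂ} {B : Matrix (Fin n) (Fin m) ℂ}
  {Ψ : CircleAngle → Matrix (Fin m) (Fin m) ℂ}

lemma dualFunctional_eq_add (S S' Λ : Matrix (Fin n) (Fin n) ℂ) :
    dualFunctional A B Ψ S' Λ = dualFunctional A B Ψ S Λ + rtr n (Λ * (S' - S)) := by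
  rw [dualFunctional, dualFunctional, Complex.add_re, Complex.add_re, mul_sub, map_sub,
    rtr_apply, rtr_apply]
  ring

lemma isDualMinimizer_optMultiplier (hA : IsStable A) (hB : B.rank = m)
    (hΨ : IsSpectralDensity Ψ) {S : Matrix (Fin n) (Fin n) ℂ} (hS : S ∈ PGamma A B) :
    IsDualMinimizer A B Ψ S (optMultiplier A B Ψ S) :=
  Classical.epsilon_spec (exists_isDualMinimizer hA hB hΨ hS)

/-- The minimum point depends continuously on the datum. -/
lemma continuous_optMultiplier (hA : IsStable A) (hB : B.rank = m) (hΨ : IsSpectralDensity Ψ) :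
    Continuous fun S : PGamma A B => optMultiplier A B Ψ (S : Matrix (Fin n) (Fin n) ℂ) := by
  rw [Metric.continuous_iff]
  rintro ⟨S, hS⟩ ρ hρ
  have hmin := isDualMinimizer_optMultiplier hA hB hΨ hS
  set Λ := optMultiplier A B Ψ S with hΛ
  obtain ⟨r₀, hr₀, hball⟩ := exists_closedBall_subset_LGamma hA hmin.1
  set r := min r₀ ρ with hr
  have hr0 : 0 < r := lt_min hr₀ hρ
  set K : Set (Matrix (Fin n) (Fin n) ℂ) :=
    (gammaRange hA B : Set (Matrix (Fin n) (Fin n) ℂ)) ∩ Metric.sphere Λ r with hK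
  have hKL : K ⊆ LGamma A B := fun L hL => hball L hL.1 <| by
    rw [← dist_eq_norm, Metric.mem_sphere.1 hL.2]
    exact min_le_left _ _
  have hKc : IsCompact K := by
    have : ProperSpace (Matrix (Fin n) (Fin n) ℂ) := FiniteDimensional.proper ℂ _
    exact (isCompact_sphere Λ r).inter_left
      (Submodule.closed_of_finiteDimensional (gammaRange hA B))
  -- By uniqueness J(·;S) exceeds its minimum at each point of the compact sphere, hence by a
  -- uniform gap η.
  obtain ⟨a, ha, haK⟩ := hKc.exists_forall_le'
    ((continuousOn_dualFunctional hA hΨ S).mono hKL) (a := dualFunctional A B Ψ S Λ) fun L hL => by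
      refine lt_of_le_of_ne (hmin.2 (hKL hL)) fun heq => ?_
      have hL' : IsDualMinimizer A B Ψ S L :=
        ⟨hKL hL, fun T hT => heq.symm.le.trans (hmin.2 hT)⟩
      have h1 := Metric.mem_sphere.1 hL.2
      rw [isDualMinimizer_unique hA hΨ hL' hmin, dist_self] at h1
      exact hr0.ne h1
  set η := a - dualFunctional A B Ψ S Λ with hη
  have hη0 : 0 < η := sub_pos.2 ha
  refine ⟨η / (‖rtr n‖ * r + 1), by positivity, ?_⟩
  rintro ⟨S', hS'⟩ hd
  have hmin' := isDualMinimizer_optMultiplier hA hB hΨ hS'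
  simp only
  set L := optMultiplier A B Ψ S' with hL
  rw [Subtype.dist_eq, dist_eq_norm, lt_div_iff₀ (by positivity)] at hd
  by_contra! hfar
  have hfar' : r ≤ ‖L - Λ‖ := (min_le_right _ _).trans (by rwa [← dist_eq_norm])
  have hN : 0 < ‖L - Λ‖ := hr0.trans_le hfar'
  -- T is the point where the segment from Λ to the far minimum point L crosses the sphere.
  -- Convexity gives J(T;S') ≤ J(Λ;S'), while replacing S by S' changes J(T) - J(Λ) by tr((T - Λ)(S'
  -- - S)), smaller in size than η.
  set t := r / ‖L - Λ‖ with ht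
  have ht0 : 0 ≤ t := by positivity
  have ht1 : t ≤ 1 := (div_le_one hN).2 hfar'
  set T := (1 - t) • Λ + t • L with hT
  have hTΛ : T - Λ = t • (L - Λ) := by
    rw [hT]
    module
  have hTr : ‖T - Λ‖ = r := by
    rw [hTΛ, norm_smul, Real.norm_of_nonneg ht0, ht, div_mul_cancel₀ _ hN.ne']
  have hTK : T ∈ K := by
    refine ⟨?_, by rw [Metric.mem_sphere, dist_eq_norm, hTr]⟩
    exact (gammaRange hA B).convex ((mem_gammaRange hA).2 hmin.1.2.2)
      ((mem_gammaRange hA).2 hmin'.1.2.2) (by linarith) ht0 (by ring)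
  have h1 := (convexOn_dualFunctional (B := B) hA hΨ S').2 hmin.1 hmin'.1
    (show 0 ≤ 1 - t by linarith) ht0 (by ring)
  rw [smul_eq_mul, smul_eq_mul, ← hT] at h1
  have h2 : dualFunctional A B Ψ S' L ≤ dualFunctional A B Ψ S' Λ := hmin'.2 hmin.1
  have h3 : dualFunctional A B Ψ S' T ≤ dualFunctional A B Ψ S' Λ := by
    have := mul_le_mul_of_nonneg_left h2 ht0
    linarith
  have h4 := haK T hTK
  rw [dualFunctional_eq_add S S' T, dualFunctional_eq_add S S' Λ] at h3
  have h5 : |rtr n ((T - Λ) * (S' - S))| ≤ ‖rtr n‖ * (r * ‖S' - S‖) := by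
    refine ((rtr n).le_opNorm _).trans (mul_le_mul_of_nonneg_left ?_ (norm_nonneg _))
    rw [← hTr]
    exact norm_mul_le _ _
  rw [sub_mul, map_sub] at h5
  have h6 := (abs_le.1 h5).1
  have h7 := norm_nonneg (S' - S)
  nlinarith

lemma IsSpectralDensity.memLp_conj (hΨ : IsSpectralDensity Ψ)
    (X Y : C(CircleAngle, Matrix (Fin m) (Fin m) ℂ)) :
    MemLp (fun θ => X θ * Ψ θ * Y θ) ∞ circleMeasure := by
  obtain ⟨K, hK0, hK⟩ := hΨ.exists_norm_le
  refine MemLp.of_bound ((X.continuous.aestronglyMeasurable.mul hΨ.aestronglyMeasurable).mul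
    Y.continuous.aestronglyMeasurable) (‖X‖ * K * ‖Y‖) ?_
  filter_upwards [hK] with θ hθ
  refine (norm_mul_le _ _).trans (mul_le_mul ((norm_mul_le _ _).trans
    (mul_le_mul (X.norm_coe_le_norm θ) hθ (norm_nonneg _) (norm_nonneg _)))
    (Y.norm_coe_le_norm θ) (norm_nonneg _) (by positivity))

/-- The map `X ↦ X Ψ X` is continuous from the continuous functions to `L_∞`. -/
lemma IsSpectralDensity.continuous_conj (hΨ : IsSpectralDensity Ψ) :
    Continuous fun X : C(CircleAngle, Matrix (Fin m) (Fin m) ℂ) =>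
      (hΨ.memLp_conj X X).toLp (fun θ => X θ * Ψ θ * X θ) := by
  obtain ⟨K, hK0, hK⟩ := hΨ.exists_norm_le
  refine continuous_iff_continuousAt.2 fun Y => ?_
  have hlim : Filter.Tendsto (fun X : C(CircleAngle, Matrix (Fin m) (Fin m) ℂ) =>
      K * ‖X - Y‖ * (‖X‖ + ‖Y‖)) (nhds Y) (nhds 0) := by
    have hc : Continuous fun X : C(CircleAngle, Matrix (Fin m) (Fin m) ℂ) =>
        K * ‖X - Y‖ * (‖X‖ + ‖Y‖) := by fun_prop
    simpa using hc.tendsto Y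
  refine tendsto_iff_norm_sub_tendsto_zero.2 (squeeze_zero (fun _ => norm_nonneg _) (fun X => ?_)
    hlim)
  rw [← MemLp.toLp_sub]
  refine (Lp.norm_le_of_ae_bound (C := K * ‖X - Y‖ * (‖X‖ + ‖Y‖)) (by positivity) ?_).trans
    (by simp)
  filter_upwards [hK, MemLp.coeFn_toLp ((hΨ.memLp_conj X X).sub (hΨ.memLp_conj Y Y))] with θ hθ h
  rw [h]
  simp only [Pi.sub_apply]
  have e : X θ * Ψ θ * X θ - Y θ * Ψ θ * Y θ =
      (X - Y) θ * Ψ θ * X θ + Y θ * Ψ θ * (X - Y) θ := by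
    rw [ContinuousMap.sub_apply]
    noncomm_ring
  have hb : ∀ P T : C(CircleAngle, Matrix (Fin m) (Fin m) ℂ),
      ‖P θ * Ψ θ * T θ‖ ≤ ‖P‖ * K * ‖T‖ := fun P T =>
    (norm_mul_le _ _).trans (mul_le_mul ((norm_mul_le _ _).trans
      (mul_le_mul (P.norm_coe_le_norm θ) hθ (norm_nonneg _) (norm_nonneg _)))
      (T.norm_coe_le_norm θ) (norm_nonneg _) (by positivity))
  rw [e]
  refine (norm_add_le _ _).trans ((add_le_add (hb _ _) (hb _ _)).trans (le_of_eq ?_))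
  ring

lemma optSpectrum_eq (hA : IsStable A) (hB : B.rank = m) (hΨ : IsSpectralDensity Ψ)
    {S : Matrix (Fin n) (Fin n) ℂ} (hS : S ∈ PGamma A B) :
    optSpectrum A B Ψ S = fun θ =>
      Ring.inverse (1 + compression hA B (optMultiplier A B Ψ S)) θ * Ψ θ *
        Ring.inverse (1 + compression hA B (optMultiplier A B Ψ S)) θ := by
  funext θ
  rw [inverse_apply (isUnit_of_mem_LGamma hA (isDualMinimizer_optMultiplier hA hB hΨ hS).1)]
  rfl

end Continuity

end HellingerSpectrum

end

theorem mainTheorem6 {n m : ℕ} (A : Matrix (Fin n) (Fin n) ℂ) (B : Matrix (Fin n) (Fin m) ℂ)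
    (hA : HellingerSpectrum.IsStable A) (hB : B.rank = m)
    (hAB : HellingerSpectrum.IsReachable A B)
    (Ψ : HellingerSpectrum.CircleAngle → Matrix (Fin m) (Fin m) ℂ)
    (hΨ : HellingerSpectrum.IsSpectralDensity Ψ) :
    (∀ S ∈ HellingerSpectrum.PGamma A B,
      ∃! L : Matrix (Fin n) (Fin n) ℂ, HellingerSpectrum.IsDualMinimizer A B Ψ S L) ∧
    ∃ hmem : ∀ S : HellingerSpectrum.PGamma A B,
        MemLp (HellingerSpectrum.optSpectrum A B Ψ (S : Matrix (Fin n) (Fin n) ℂ)) ∞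
          HellingerSpectrum.circleMeasure,
      Continuous (fun S : HellingerSpectrum.PGamma A B => (hmem S).toLp
        (HellingerSpectrum.optSpectrum A B Ψ (S : Matrix (Fin n) (Fin n) ℂ))) := by
  refine ⟨fun S hS => ?_, ?_⟩
  · obtain ⟨Λ, hΛ⟩ := HellingerSpectrum.exists_isDualMinimizer hA hB hΨ hS
    exact ⟨Λ, hΛ, fun L hL => HellingerSpectrum.isDualMinimizer_unique hA hΨ hL hΛ⟩
  · have heq : ∀ S : HellingerSpectrum.PGamma A B, _ := fun S =>
      HellingerSpectrum.optSpectrum_eq hA hB hΨ S.2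
    refine ⟨fun S => by rw [heq S]; exact hΨ.memLp_conj _ _, ?_⟩
    have hinv : Continuous fun S : HellingerSpectrum.PGamma A B =>
        Ring.inverse (1 + HellingerSpectrum.compression hA B
          (HellingerSpectrum.optMultiplier A B Ψ (S : Matrix (Fin n) (Fin n) ℂ))) :=
      continuous_iff_continuousAt.2 fun S => ContinuousAt.comp
        (f := fun S : HellingerSpectrum.PGamma A B =>
          HellingerSpectrum.optMultiplier A B Ψ (S : Matrix (Fin n) (Fin n) ℂ))
        (HellingerSpectrum.continuousAt_inverse_Q hA
          (HellingerSpectrum.isDualMinimizer_optMultiplier hA hB hΨ S.2).1)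
        (HellingerSpectrum.continuous_optMultiplier hA hB hΨ).continuousAt
    refine (hΨ.continuous_conj.comp hinv).congr fun S => ?_
    exact (MemLp.toLp_congr _ (hΨ.memLp_conj _ _) (Filter.EventuallyEq.of_eq (heq S))).symm
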